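/- Let $k$ be a field and let $Q$ be a finite quiver with vertex set $I$ (finitely many vertices and finitely many arrows; loops and multiple arrows are allowed). Let $kQ$ be its path algebra, where $pq$ denotes the path $q$ followed by the path $p$ (and $pq=0$ if $q$ does not end where $p$ starts), graded by path length. Let $\mathsf{Gr}(kQ)$ be the category of $\mathbb Z$-graded left $kQ$-modules with degree-preserving homomorphisms, $\mathsf{gr}(kQ)$ its full subcategory of finitely presented modules, and $\mathsf{fdim}(kQ)\subset\mathsf{gr}(kQ)$ the full subcategory of finite-dimensional modules. Let $\mathsf{qgr}(kQ)=\mathsf{gr}(kQ)/\mathsf{fdim}(kQ)$ be the quotient category, that is, the localization of $\mathsf{gr}(kQ)$ at the morphisms with finite-dimensional kernel and cokernel, and let $\pi^*:\mathsf{gr}(kQ)\to\mathsf{qgr}(kQ)$ be the quotient functor. For $i\in I$ let $e_i$ be the trivial path at $i$ and $P_i=(kQ)e_i$. For a graded module $M$ write $M(n)$ for the shift with $M(n)_j=M_{n+j}$ and $M_{\ge n}=\bigoplus_{j\ge n}M_j$. Then: 1. A finitely generated graded left $kQ$-module $M$ is finitely presented if and only if for all sufficiently large $n$ there are integers $m_i\ge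 0$ $(i\in I)$, depending on $M$ and $n$, and an isomorphism $M_{\ge n}\cong\bigoplus_{i\in I}P_i(-n)^{\oplus m_i}$ in $\mathsf{Gr}(kQ)$. 2. If $0\to L\to M\to N\to 0$ is an exact sequence in $\mathsf{gr}(kQ)$, then the sequence $0\to L_{\ge n}\to M_{\ge n}\to N_{\ge n}\to 0$ splits in $\mathsf{Gr}(kQ)$ for all sufficiently large $n$. 3. For every object $\mathcal M$ of $\mathsf{qgr}(kQ)$ there is an $M$ in $\mathsf{gr}(kQ)$, projective in $\mathsf{Gr}(kQ)$, such that $\mathcal M\cong\pi^*M$. 4. Every short exact sequence in $\mathsf{qgr}(kQ)$ splits. 5. Every object of $\mathsf{qgr}(kQ)$ is both injective and projective. -/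

import Mathlib

open CategoryTheory

universe u v w

noncomputable section

/-! ### The path algebra -/

/-- All paths of the quiver `Q`, of any length (including the trivial ones), as triples
(starting point, end point, path). -/
abbrev QuiverPaths (Q : Type v) [Quiver.{w} Q] : Type (max v w) :=
  Σ (a : Q) (b : Q), Quiver.Path a b

/-- The path algebra `kQ`: the `k`-vector space with basis the set of paths of `Q`. -/
def PathAlgebra (k : Type u) [Field k] (Q : Type v) [Quiver.{w} Q] : Type (max u v w) :=
  QuiverPaths Q →₀ k

namespace PathAlgebra

variable (k : Type u) [Field k] {Q : Type v} [Quiver.{w} Q]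

instance : AddCommGroup (PathAlgebra k Q) := inferInstanceAs (AddCommGroup (QuiverPaths Q →₀ k))

instance : Module k (PathAlgebra k Q) := inferInstanceAs (Module k (QuiverPaths Q →₀ k))

/-- The paths form a basis of `kQ`. -/
def basis : Module.Basis (QuiverPaths Q) k (PathAlgebra k Q) :=
  Module.Basis.ofRepr (LinearEquiv.refl k (QuiverPaths Q →₀ k))

/-- The element of `kQ` given by a path. -/
def ofPath (p : QuiverPaths Q) : PathAlgebra k Q := basis k p

open Classical in
/-- The product `pq` of two paths is the path `q` followed by the path `p` if `q` ends where
`p` starts, and it is zero otherwise. -/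
def mulPath (p q : QuiverPaths Q) : PathAlgebra k Q :=
  if h : q.2.1 = p.1 then ofPath k ⟨q.1, p.2.1, q.2.2.comp (p.2.2.cast h.symm rfl)⟩ else 0

/-- The `k`-bilinear extension of the product of paths. -/
def mulLin : PathAlgebra k Q →ₗ[k] PathAlgebra k Q →ₗ[k] PathAlgebra k Q :=
  (basis k).constr k fun p => (basis k).constr k fun q => mulPath k p q

instance : Mul (PathAlgebra k Q) := ⟨fun x y => mulLin k x y⟩

/-- The trivial path `e_i` at the vertex `i`. -/
def e (i : Q) : PathAlgebra k Q := ofPath k ⟨i, i, Quiver.Path.nil⟩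

instance [Fintype Q] : One (PathAlgebra k Q) := ⟨∑ i : Q, e k i⟩

variable {k}

theorem mul_def (x y : PathAlgebra k Q) : x * y = mulLin k x y := rfl

theorem ofPath_mul_ofPath (p q : QuiverPaths Q) :
    ofPath k p * ofPath k q = mulPath k p q := by
  rw [mul_def, mulLin, ofPath, ofPath, Module.Basis.constr_basis, Module.Basis.constr_basis]

theorem mulPath_of_eq {a b c : Q} (p : Quiver.Path b c) (q : Quiver.Path a b) :
    mulPath k ⟨b, c, p⟩ ⟨a, b, q⟩ = ofPath k ⟨a, c, q.comp p⟩ := by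
  simp [mulPath]

theorem mulPath_of_ne (p q : QuiverPaths Q) (h : q.2.1 ≠ p.1) : mulPath k p q = 0 := by
  simp [mulPath, h]

@[elab_as_elim]
theorem induction {motive : PathAlgebra k Q → Prop} (x : PathAlgebra k Q)
    (zero : motive 0) (add : ∀ x y, motive x → motive y → motive (x + y))
    (smul : ∀ (c : k) x, motive x → motive (c • x))
    (path : ∀ p, motive (ofPath k p)) : motive x := by
  have hx : x ∈ Submodule.span k (Set.range (basis (Q := Q) k)) := by
    rw [(basis k).span_eq]; trivial
  induction hx using Submodule.span_induction with
  | mem x h => obtain ⟨p, rfl⟩ := h; exact path p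
  | zero => exact zero
  | add x y _ _ hx hy => exact add x y hx hy
  | smul c x _ hx => exact smul c x hx

protected theorem smul_mul (c : k) (x y : PathAlgebra k Q) : (c • x) * y = c • (x * y) := by
  simp [mul_def]

protected theorem mul_smul (c : k) (x y : PathAlgebra k Q) : x * (c • y) = c • (x * y) := by
  simp [mul_def]

protected theorem add_mul' (x y z : PathAlgebra k Q) : (x + y) * z = x * z + y * z := by
  simp [mul_def]

protected theorem mul_add' (x y z : PathAlgebra k Q) : x * (y + z) = x * y + x * z := by
  simp [mul_def]

protected theorem zero_mul' (x : PathAlgebra k Q) : 0 * x = 0 := by simp [mul_def]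

protected theorem mul_zero' (x : PathAlgebra k Q) : x * 0 = 0 := by simp [mul_def]

theorem ofPath_mul_assoc (p q r : QuiverPaths Q) :
    ofPath k p * ofPath k q * ofPath k r = ofPath k p * (ofPath k q * ofPath k r) := by
  obtain ⟨c, d, p⟩ := p
  obtain ⟨b, c', q⟩ := q
  obtain ⟨a, b', r⟩ := r
  simp only [ofPath_mul_ofPath]
  by_cases h : c' = c
  · subst h
    rw [mulPath_of_eq, ofPath_mul_ofPath]
    by_cases h' : b' = b
    · subst h'
      rw [mulPath_of_eq, mulPath_of_eq, ofPath_mul_ofPath, mulPath_of_eq,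
        Quiver.Path.comp_assoc]
    · rw [mulPath_of_ne _ _ h', mulPath_of_ne _ _ h', PathAlgebra.mul_zero']
  · rw [mulPath_of_ne _ _ h, PathAlgebra.zero_mul']
    by_cases h' : b' = b
    · subst h'
      rw [mulPath_of_eq, ofPath_mul_ofPath, mulPath_of_ne _ _ h]
    · rw [mulPath_of_ne _ _ h', PathAlgebra.mul_zero']

protected theorem mul_assoc' (x y z : PathAlgebra k Q) : x * y * z = x * (y * z) := by
  induction x using PathAlgebra.induction with
  | zero => simp [PathAlgebra.zero_mul']
  | add x x' hx hx' => simp [PathAlgebra.add_mul', hx, hx']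
  | smul c x hx => simp [PathAlgebra.smul_mul, hx]
  | path p =>
  induction y using PathAlgebra.induction with
  | zero => simp [PathAlgebra.zero_mul', PathAlgebra.mul_zero']
  | add x x' hx hx' => simp [PathAlgebra.add_mul', PathAlgebra.mul_add', hx, hx']
  | smul c x hx => simp [PathAlgebra.smul_mul, PathAlgebra.mul_smul, hx]
  | path q =>
  induction z using PathAlgebra.induction with
  | zero => simp [PathAlgebra.mul_zero']
  | add x x' hx hx' => simp [PathAlgebra.mul_add', hx, hx']
  | smul c x hx => simp [PathAlgebra.mul_smul, hx]
  | path r => exact ofPath_mul_assoc p q r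

theorem e_mul_ofPath (i : Q) (p : QuiverPaths Q) [Decidable (p.2.1 = i)] :
    e k i * ofPath k p = if p.2.1 = i then ofPath k p else 0 := by
  obtain ⟨a, b, p⟩ := p
  rw [e, ofPath_mul_ofPath]
  split_ifs with h
  · obtain rfl : b = i := h
    rw [mulPath_of_eq, Quiver.Path.comp_nil]
  · exact mulPath_of_ne _ _ h

theorem ofPath_mul_e (i : Q) (p : QuiverPaths Q) [Decidable (i = p.1)] :
    ofPath k p * e k i = if i = p.1 then ofPath k p else 0 := by
  obtain ⟨a, b, p⟩ := p
  rw [e, ofPath_mul_ofPath]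
  split_ifs with h
  · obtain rfl : i = a := h
    rw [mulPath_of_eq, Quiver.Path.nil_comp]
  · exact mulPath_of_ne _ _ h

variable (k Q) in
/-- The component of `kQ` of degree `j`: the linear span of the paths of length `j`
(zero for `j < 0`). -/
def deg (j : ℤ) : Submodule k (PathAlgebra k Q) :=
  Submodule.span k {x | ∃ p : QuiverPaths Q, (p.2.2.length : ℤ) = j ∧ x = ofPath k p}

variable (k Q) in
theorem ofPath_mem_deg (p : QuiverPaths Q) : ofPath k p ∈ deg k Q p.2.2.length :=
  Submodule.subset_span ⟨p, rfl, rfl⟩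

variable (k) in
theorem e_mem_deg (i : Q) : e k i ∈ deg k Q 0 :=
  Submodule.subset_span ⟨⟨i, i, Quiver.Path.nil⟩, by simp, rfl⟩

variable [Fintype Q]

theorem one_def : (1 : PathAlgebra k Q) = ∑ i : Q, e k i := rfl

open Classical in
protected theorem one_mul' (x : PathAlgebra k Q) : 1 * x = x := by
  induction x using PathAlgebra.induction with
  | zero => rw [PathAlgebra.mul_zero']
  | add x y hx hy => rw [PathAlgebra.mul_add', hx, hy]
  | smul c x hx => rw [PathAlgebra.mul_smul, hx]
  | path p =>
    rw [one_def, mul_def, map_sum, LinearMap.sum_apply]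
    simp only [← mul_def, e_mul_ofPath, Finset.sum_ite_eq, Finset.mem_univ, if_true]

open Classical in
protected theorem mul_one' (x : PathAlgebra k Q) : x * 1 = x := by
  induction x using PathAlgebra.induction with
  | zero => rw [PathAlgebra.zero_mul']
  | add x y hx hy => rw [PathAlgebra.add_mul', hx, hy]
  | smul c x hx => rw [PathAlgebra.smul_mul, hx]
  | path p =>
    rw [one_def, mul_def, map_sum]
    simp only [← mul_def, ofPath_mul_e, Finset.sum_ite_eq', Finset.mem_univ, if_true]

instance : Ring (PathAlgebra k Q) :=
  { (inferInstance : AddCommGroup (PathAlgebra k Q)),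
    (inferInstance : Mul (PathAlgebra k Q)),
    (inferInstance : One (PathAlgebra k Q)) with
    left_distrib := PathAlgebra.mul_add'
    right_distrib := PathAlgebra.add_mul'
    zero_mul := PathAlgebra.zero_mul'
    mul_zero := PathAlgebra.mul_zero'
    mul_assoc := PathAlgebra.mul_assoc'
    one_mul := PathAlgebra.one_mul'
    mul_one := PathAlgebra.mul_one' }

instance : Algebra k (PathAlgebra k Q) :=
  Algebra.ofModule PathAlgebra.smul_mul PathAlgebra.mul_smul

theorem mul_mem_deg {i j : ℤ} {x y : PathAlgebra k Q} (hx : x ∈ deg k Q i)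
    (hy : y ∈ deg k Q j) : x * y ∈ deg k Q (i + j) := by
  induction hx using Submodule.span_induction with
  | zero => simp
  | add a b _ _ ha hb => rw [add_mul]; exact add_mem ha hb
  | smul c a _ ha => rw [smul_mul_assoc]; exact Submodule.smul_mem _ _ ha
  | mem a h =>
  obtain ⟨p, hp, rfl⟩ := h
  induction hy using Submodule.span_induction with
  | zero => simp
  | add a b _ _ ha hb => rw [mul_add]; exact add_mem ha hb
  | smul c a _ ha => rw [mul_smul_comm]; exact Submodule.smul_mem _ _ ha
  | mem a h =>
  obtain ⟨q, hq, rfl⟩ := h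
  obtain ⟨b, c, p⟩ := p
  obtain ⟨a, b', q⟩ := q
  rw [ofPath_mul_ofPath]
  by_cases h : b' = b
  · subst h
    rw [mulPath_of_eq]
    refine Submodule.subset_span ⟨_, ?_, rfl⟩
    simp only [Quiver.Path.length_comp] at *
    omega
  · rw [mulPath_of_ne _ _ h]
    exact zero_mem _

end PathAlgebra

/-! ### Graded modules -/

/-- A sum of submodules is direct as soon as there are projections onto the summands. -/
theorem isInternal_of_proj {k M : Type*} [Ring k] [AddCommGroup M] [Module k M]
    (A : ℤ → Submodule k M) (p : ℤ → M →ₗ[k] M) (h₁ : ∀ j, ∀ x ∈ A j, p j x = x)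
    (h₂ : ∀ i j, i ≠ j → ∀ x ∈ A i, p j x = 0) (h₃ : ∀ x, x ∈ ⨆ j, A j) :
    DirectSum.IsInternal A := by
  rw [DirectSum.isInternal_submodule_iff_iSupIndep_and_iSup_eq_top]
  refine ⟨fun i => ?_, eq_top_iff.2 fun x _ => h₃ x⟩
  rw [Submodule.disjoint_def]
  intro x hx hx'
  have : ⨆ j, ⨆ (_ : j ≠ i), A j ≤ LinearMap.ker (p i) :=
    iSup₂_le fun j hj y hy => h₂ j i hj y hy
  rw [← h₁ i x hx]
  exact this hx'

/-- A `ℤ`-graded left `kQ`-module: a left `kQ`-module `M` (with its induced `k`-vector space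
structure) that is the direct sum of subspaces `M_j`, `j ∈ ℤ`, such that
`(kQ)_i M_j ⊆ M_{i+j}`. -/
structure GrMod (k : Type u) [Field k] (Q : Type v) [Quiver.{w} Q] [Fintype Q] where
  carrier : Type (max u v w)
  [addCommGroup : AddCommGroup carrier]
  [moduleField : Module k carrier]
  [module : Module (PathAlgebra k Q) carrier]
  [isScalarTower : IsScalarTower k (PathAlgebra k Q) carrier]
  deg : ℤ → Submodule k carrier
  isInternal : DirectSum.IsInternal deg
  smul_mem : ∀ (i j : ℤ) (a : PathAlgebra k Q) (x : carrier),
    a ∈ PathAlgebra.deg k Q i → x ∈ deg j → a • x ∈ deg (i + j)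

namespace GrMod

variable {k : Type u} [Field k] {Q : Type v} [Quiver.{w} Q] [Fintype Q]

instance : CoeSort (GrMod k Q) (Type (max u v w)) := ⟨carrier⟩

instance (M : GrMod k Q) : AddCommGroup M := M.addCommGroup
instance (M : GrMod k Q) : Module k M := M.moduleField
instance (M : GrMod k Q) : Module (PathAlgebra k Q) M := M.module
instance (M : GrMod k Q) : IsScalarTower k (PathAlgebra k Q) M := M.isScalarTower

/-- The projection of `M` onto its component of degree `j`. -/
def proj (M : GrMod k Q) (j : ℤ) : M →ₗ[k] M :=
  (M.deg j).subtype ∘ₗ DirectSum.component k ℤ (fun i => M.deg i) j ∘ₗ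
    (LinearEquiv.ofBijective (DirectSum.coeLinearMap M.deg) M.isInternal).symm.toLinearMap

theorem proj_mem (M : GrMod k Q) (j : ℤ) (x : M) : M.proj j x ∈ M.deg j :=
  Submodule.coe_mem _

theorem proj_of_mem (M : GrMod k Q) (i j : ℤ) {x : M} (hx : x ∈ M.deg i) :
    M.proj j x = if i = j then x else 0 := by
  have : (LinearEquiv.ofBijective (DirectSum.coeLinearMap M.deg) M.isInternal).symm x =
      DirectSum.lof k ℤ (fun i => M.deg i) i ⟨x, hx⟩ := by
    rw [LinearEquiv.symm_apply_eq]
    exact (DirectSum.coeLinearMap_lof (A := M.deg) i ⟨x, hx⟩).symm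
  simp only [proj, LinearMap.comp_apply, LinearEquiv.coe_coe, this]
  split_ifs with h
  · subst h
    simp
  · rw [DirectSum.component.of, dif_neg h]
    simp

theorem iSup_deg (M : GrMod k Q) : ⨆ j, M.deg j = ⊤ :=
  M.isInternal.submodule_iSup_eq_top

@[elab_as_elim]
theorem induction (M : GrMod k Q) {motive : M → Prop} (x : M) (zero : motive 0)
    (add : ∀ x y, motive x → motive y → motive (x + y))
    (mem : ∀ j, ∀ x ∈ M.deg j, motive x) : motive x :=
  Submodule.iSup_induction M.deg (motive := motive) (x := x)
    (by rw [M.iSup_deg]; trivial) mem zero add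

theorem exists_sum_proj (M : GrMod k Q) (x : M) :
    ∃ s : Finset ℤ, ∀ t : Finset ℤ, s ⊆ t → ∑ j ∈ t, M.proj j x = x := by
  classical
  induction x using M.induction with
  | zero => exact ⟨∅, by simp⟩
  | add x y hx hy =>
    obtain ⟨s, hs⟩ := hx
    obtain ⟨s', hs'⟩ := hy
    refine ⟨s ∪ s', fun t ht => ?_⟩
    simp only [map_add, Finset.sum_add_distrib]
    rw [hs t (Finset.union_subset_left ht), hs' t (Finset.union_subset_right ht)]
  | mem j x hx =>
    refine ⟨{j}, fun t ht => ?_⟩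
    rw [Finset.sum_congr rfl fun i _ => M.proj_of_mem j i hx]
    simp [Finset.singleton_subset_iff.1 ht]

theorem proj_smul (M : GrMod k Q) {i : ℤ} {a : PathAlgebra k Q}
    (ha : a ∈ PathAlgebra.deg k Q i) (j : ℤ) (x : M) :
    M.proj j (a • x) = a • M.proj (j - i) x := by
  induction x using M.induction with
  | zero => simp
  | add x y hx hy => simp [smul_add, hx, hy]
  | mem l x hx =>
    rw [M.proj_of_mem _ _ hx, M.proj_of_mem _ _ (M.smul_mem i l a x ha hx)]
    by_cases h : i + l = j
    · rw [if_pos h, if_pos (by omega)]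
    · rw [if_neg h, if_neg (by omega), smul_zero]

/-- A homomorphism of graded modules: a `kQ`-linear map preserving degrees. -/
@[ext]
structure Hom (M N : GrMod k Q) where
  hom : M →ₗ[PathAlgebra k Q] N
  map_mem : ∀ (j : ℤ) (x : M), x ∈ M.deg j → hom x ∈ N.deg j

/-- The category `Gr(kQ)` of `ℤ`-graded left `kQ`-modules and degree-preserving
homomorphisms. -/
instance : Category (GrMod k Q) where
  Hom := Hom
  id M := ⟨LinearMap.id, fun _ _ h => h⟩
  comp f g := ⟨g.hom ∘ₗ f.hom, fun j x h => g.map_mem j _ (f.map_mem j x h)⟩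

@[ext]
theorem hom_ext {M N : GrMod k Q} {f g : M ⟶ N} (h : ∀ x, f.hom x = g.hom x) : f = g :=
  Hom.ext (LinearMap.ext h)

@[simp] theorem id_hom (M : GrMod k Q) : Hom.hom (𝟙 M) = LinearMap.id := rfl

@[simp] theorem comp_hom {M N P : GrMod k Q} (f : M ⟶ N) (g : N ⟶ P) :
    (f ≫ g).hom = g.hom ∘ₗ f.hom := rfl

theorem hom_proj {M N : GrMod k Q} (f : M ⟶ N) (j : ℤ) (x : M) :
    f.hom (M.proj j x) = N.proj j (f.hom x) := by
  induction x using M.induction with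
  | zero => simp
  | add x y hx hy => simp [hx, hy]
  | mem l x hx =>
    rw [M.proj_of_mem _ _ hx, N.proj_of_mem _ _ (f.map_mem l x hx)]
    split_ifs <;> simp

section Preadditive

variable {M N : GrMod k Q}

instance : Zero (M ⟶ N) := ⟨⟨0, fun j _ _ => (N.deg j).zero_mem⟩⟩
instance : Add (M ⟶ N) :=
  ⟨fun f g => ⟨f.hom + g.hom, fun j x h => add_mem (f.map_mem j x h) (g.map_mem j x h)⟩⟩
instance : Neg (M ⟶ N) := ⟨fun f => ⟨-f.hom, fun j x h => neg_mem (f.map_mem j x h)⟩⟩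
instance : Sub (M ⟶ N) :=
  ⟨fun f g => ⟨f.hom - g.hom, fun j x h => sub_mem (f.map_mem j x h) (g.map_mem j x h)⟩⟩
instance : SMul ℕ (M ⟶ N) :=
  ⟨fun n f => ⟨n • f.hom, fun j x h => nsmul_mem (f.map_mem j x h) n⟩⟩
instance : SMul ℤ (M ⟶ N) :=
  ⟨fun n f => ⟨n • f.hom, fun j x h => zsmul_mem (f.map_mem j x h) n⟩⟩

@[simp] theorem zero_hom : (0 : M ⟶ N).hom = 0 := rfl
@[simp] theorem add_hom (f g : M ⟶ N) : (f + g).hom = f.hom + g.hom := rfl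
@[simp] theorem neg_hom (f : M ⟶ N) : (-f).hom = -f.hom := rfl
@[simp] theorem sub_hom (f g : M ⟶ N) : (f - g).hom = f.hom - g.hom := rfl

instance : AddCommGroup (M ⟶ N) :=
  Function.Injective.addCommGroup (fun f : M ⟶ N => f.hom) (fun _ _ h => Hom.ext h) rfl
    (fun _ _ => rfl) (fun _ => rfl) (fun _ _ => rfl) (fun _ _ => rfl) (fun _ _ => rfl)

instance : Preadditive (GrMod k Q) where
  add_comp _ _ _ f f' g := by ext x; simp
  comp_add _ _ _ f g g' := by ext x; simp

end Preadditive

/-- A `kQ`-submodule is homogeneous if it contains the homogeneous components of all its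
elements. -/
def IsHomogeneous (M : GrMod k Q) (N : Submodule (PathAlgebra k Q) M) : Prop :=
  ∀ x ∈ N, ∀ j, M.proj j x ∈ N

/-- A homogeneous submodule as a graded module. -/
def ofSubmodule (M : GrMod k Q) (N : Submodule (PathAlgebra k Q) M) (hN : M.IsHomogeneous N) :
    GrMod k Q where
  carrier := N
  deg j := (M.deg j).comap (N.subtype.restrictScalars k)
  isInternal := by
    refine isInternal_of_proj _
      (fun j => (M.proj j).restrict (p := N.restrictScalars k) (q := N.restrictScalars k)
        fun x hx => hN x hx j) ?_ ?_ ?_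
    · rintro j ⟨x, hx⟩ hj
      apply Subtype.ext
      exact (M.proj_of_mem j j hj).trans (if_pos rfl)
    · rintro i j hij ⟨x, hx⟩ hj
      apply Subtype.ext
      exact (M.proj_of_mem i j hj).trans (if_neg hij)
    · rintro ⟨x, hx⟩
      obtain ⟨s, hs⟩ := M.exists_sum_proj x
      have : (⟨x, hx⟩ : N) = ∑ j ∈ s, ⟨M.proj j x, hN x hx j⟩ := by
        apply Subtype.ext
        simp [hs s subset_rfl]
      rw [this]
      exact sum_mem fun j _ => Submodule.mem_iSup_of_mem j (M.proj_mem j x)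
  smul_mem i j a x ha hx := M.smul_mem i j a x ha hx

/-- The quotient by a homogeneous submodule as a graded module. -/
def quotient (M : GrMod k Q) (N : Submodule (PathAlgebra k Q) M) (hN : M.IsHomogeneous N) :
    GrMod k Q where
  carrier := M ⧸ N
  deg j := (M.deg j).map (N.mkQ.restrictScalars k)
  isInternal := by
    refine isInternal_of_proj _
      (fun j => (N.restrictScalars k).mapQ (N.restrictScalars k) (M.proj j)
        fun x hx => hN x hx j) ?_ ?_ ?_
    · rintro j _ ⟨x, hj, rfl⟩
      exact congrArg N.mkQ ((M.proj_of_mem j j hj).trans (if_pos rfl))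
    · rintro i j hij _ ⟨x, hj, rfl⟩
      exact (congrArg N.mkQ ((M.proj_of_mem i j hj).trans (if_neg hij))).trans (map_zero _)
    · intro x
      obtain ⟨x, rfl⟩ := N.mkQ_surjective x
      rw [← Submodule.map_iSup, M.iSup_deg]
      exact ⟨x, trivial, rfl⟩
  smul_mem i j a x ha hx := by
    obtain ⟨x, hx, rfl⟩ := hx
    exact ⟨a • x, M.smul_mem i j a x ha hx, by simp⟩

/-- The direct sum of a finite family of graded modules, with
`(⨁ M_i)_j = ⨁ (M_i)_j`. -/
def directSum {ι : Type v} [Fintype ι] (M : ι → GrMod k Q) : GrMod k Q where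
  carrier := ∀ i, M i
  deg j := Submodule.pi Set.univ fun i => (M i).deg j
  isInternal := by
    classical
    refine isInternal_of_proj _
      (fun j => LinearMap.pi fun i => (M i).proj j ∘ₗ LinearMap.proj i) ?_ ?_ ?_
    · intro j x hx
      funext i
      exact ((M i).proj_of_mem j j (hx i trivial)).trans (if_pos rfl)
    · intro l j hij x hx
      funext i
      exact ((M i).proj_of_mem l j (hx i trivial)).trans (if_neg hij)
    · intro x
      rw [← Finset.univ_sum_single x]
      refine sum_mem fun i _ => ?_
      induction x i using (M i).induction with
      | zero => simp
      | add a b ha hb => rw [Pi.single_add]; exact add_mem ha hb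
      | mem j a ha =>
        refine Submodule.mem_iSup_of_mem j fun l _ => ?_
        by_cases h : l = i
        · subst h; simpa using ha
        · simp [h]
  smul_mem i j a x ha hx := fun l _ => (M l).smul_mem i j a (x l) ha (hx l trivial)

/-- The shift `M(n)`, with `M(n)_j = M_{n+j}`. -/
def shift (M : GrMod k Q) (n : ℤ) : GrMod k Q where
  carrier := M
  deg j := M.deg (n + j)
  isInternal := by
    refine isInternal_of_proj _ (fun j => M.proj (n + j)) ?_ ?_ ?_
    · intro j x hx
      exact (M.proj_of_mem _ _ hx).trans (if_pos rfl)
    · intro i j hij x hx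
      exact (M.proj_of_mem _ _ hx).trans (if_neg (by omega))
    · intro x
      have h : ⨆ j, M.deg (n + j) = ⊤ :=
        ((Equiv.addLeft n).iSup_comp (g := M.deg)).trans M.iSup_deg
      rw [h]
      trivial
  smul_mem i j a x ha hx := by
    rw [add_left_comm]
    exact M.smul_mem i (n + j) a x ha hx

variable (k Q) in
open Classical in
/-- The graded left module `kQ`. -/
def regular : GrMod k Q where
  carrier := PathAlgebra k Q
  deg := PathAlgebra.deg k Q
  isInternal := by
    refine isInternal_of_proj _ (fun j => (PathAlgebra.basis k).constr k fun p =>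
      if (p.2.2.length : ℤ) = j then PathAlgebra.ofPath k p else 0) ?_ ?_ ?_
    · intro j x hx
      induction hx using Submodule.span_induction with
      | zero => simp
      | add a b _ _ ha hb => rw [map_add, ha, hb]
      | smul c a _ ha => rw [map_smul, ha]
      | mem a h =>
        obtain ⟨p, hp, rfl⟩ := h
        rw [PathAlgebra.ofPath, Module.Basis.constr_basis, if_pos hp]
        rfl
    · intro i j hij x hx
      induction hx using Submodule.span_induction with
      | zero => simp
      | add a b _ _ ha hb => rw [map_add, ha, hb, add_zero]
      | smul c a _ ha => rw [map_smul, ha, smul_zero]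
      | mem a h =>
        obtain ⟨p, hp, rfl⟩ := h
        rw [PathAlgebra.ofPath, Module.Basis.constr_basis, if_neg (hp.trans_ne hij)]
    · intro x
      induction x using PathAlgebra.induction with
      | zero => exact zero_mem _
      | add x y hx hy => exact add_mem hx hy
      | smul c x hx => exact Submodule.smul_mem _ _ hx
      | path p => exact Submodule.mem_iSup_of_mem _ (PathAlgebra.ofPath_mem_deg k Q p)
  smul_mem _ _ _ _ ha hx := PathAlgebra.mul_mem_deg ha hx

/-- A submodule generated by homogeneous elements is homogeneous. -/
theorem isHomogeneous_span (M : GrMod k Q) (S : Set M) (hS : ∀ x ∈ S, ∃ j, x ∈ M.deg j) :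
    M.IsHomogeneous (Submodule.span (PathAlgebra k Q) S) := by
  intro x hx j
  induction hx using Submodule.span_induction generalizing j with
  | zero => simp
  | add x y _ _ hx hy => rw [map_add]; exact add_mem (hx j) (hy j)
  | mem x hx =>
    obtain ⟨i, hi⟩ := hS x hx
    rw [M.proj_of_mem _ _ hi]
    split_ifs
    · exact Submodule.subset_span hx
    · exact zero_mem _
  | smul a x _ hx =>
    induction a using PathAlgebra.induction with
    | zero => simp
    | add a b ha hb => rw [add_smul, map_add]; exact add_mem ha hb
    | smul c a ha => rw [smul_assoc, map_smul]; exact Submodule.smul_of_tower_mem _ c ha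
    | path p =>
      rw [M.proj_smul (PathAlgebra.ofPath_mem_deg k Q p)]
      exact Submodule.smul_mem _ _ (hx _)

variable (k) in
/-- The graded left ideal `P_i = (kQ)e_i`. -/
def P (i : Q) : GrMod k Q :=
  (regular k Q).ofSubmodule (Submodule.span (PathAlgebra k Q) {PathAlgebra.e k i})
    ((regular k Q).isHomogeneous_span _ fun x hx => ⟨0, by
      obtain rfl := Set.mem_singleton_iff.1 hx
      exact PathAlgebra.e_mem_deg k i⟩)

/-- The submodule `⨁_{j ≥ n} M_j`, that is, the set of elements of `M` all of whose components
of degree `< n` are zero. -/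
def truncSubmodule (M : GrMod k Q) (n : ℤ) : Submodule (PathAlgebra k Q) M where
  carrier := {x | ∀ j < n, M.proj j x = 0}
  zero_mem' := by simp
  add_mem' hx hy j hj := by simp [hx j hj, hy j hj]
  smul_mem' a x hx := by
    induction a using PathAlgebra.induction with
    | zero => simp
    | add a b ha hb => intro j hj; rw [add_smul, map_add, ha j hj, hb j hj, add_zero]
    | smul c a ha => intro j hj; rw [smul_assoc, map_smul, ha j hj, smul_zero]
    | path p =>
      intro j hj
      rw [M.proj_smul (PathAlgebra.ofPath_mem_deg k Q p), hx _ (by omega), smul_zero]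

/-- The graded module `M_{≥n}`. -/
def trunc (M : GrMod k Q) (n : ℤ) : GrMod k Q :=
  M.ofSubmodule (M.truncSubmodule n) fun x hx i j hj => by
    rw [M.proj_of_mem i j (M.proj_mem i x)]
    split_ifs with h
    · rw [hx i (by omega)]
    · rfl

theorem map_mem_truncSubmodule {M N : GrMod k Q} (f : M ⟶ N) (n : ℤ) (x : M)
    (hx : x ∈ M.truncSubmodule n) : f.hom x ∈ N.truncSubmodule n := by
  intro j hj
  rw [← hom_proj, show M.proj j x = 0 from hx j hj, map_zero]

/-- The restriction `M_{≥n} → N_{≥n}` of a homomorphism `M → N`. -/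
def truncMap {M N : GrMod k Q} (f : M ⟶ N) (n : ℤ) : M.trunc n ⟶ N.trunc n where
  hom := (f.hom.restrict (map_mem_truncSubmodule f n) :
    M.truncSubmodule n →ₗ[PathAlgebra k Q] N.truncSubmodule n)
  map_mem j x hx := f.map_mem j x.1 hx

variable (k Q) in
/-- The functor `M ↦ M_{≥n}` on graded modules. -/
def truncFunctor (n : ℤ) : GrMod k Q ⥤ GrMod k Q where
  obj M := M.trunc n
  map f := truncMap f n
  map_id _ := rfl
  map_comp _ _ := rfl

instance (n : ℤ) : (truncFunctor k Q n).Additive where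
  map_add := rfl

/-- The product of two graded modules. -/
def prod (M N : GrMod k Q) : GrMod k Q where
  carrier := M × N
  deg j := (M.deg j).prod (N.deg j)
  isInternal := by
    refine isInternal_of_proj _ (fun j => (M.proj j).prodMap (N.proj j)) ?_ ?_ ?_
    · rintro j x ⟨hx, hx'⟩
      exact Prod.ext ((M.proj_of_mem j j hx).trans (if_pos rfl))
        ((N.proj_of_mem j j hx').trans (if_pos rfl))
    · rintro i j hij x ⟨hx, hx'⟩
      exact Prod.ext ((M.proj_of_mem i j hx).trans (if_neg hij))
        ((N.proj_of_mem i j hx').trans (if_neg hij))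
    · rintro ⟨x, y⟩
      rw [show (x, y) = (x, 0) + (0, y) by simp]
      refine add_mem ?_ ?_
      · induction x using M.induction with
        | zero => exact zero_mem _
        | add a b ha hb => rw [show (a + b, (0 : N)) = (a, 0) + (b, 0) by simp]; exact add_mem ha hb
        | mem j a ha => exact Submodule.mem_iSup_of_mem j ⟨ha, zero_mem _⟩
      · induction y using N.induction with
        | zero => exact zero_mem _
        | add a b ha hb => rw [show ((0 : M), a + b) = (0, a) + (0, b) by simp]; exact add_mem ha hb
        | mem j a ha => exact Submodule.mem_iSup_of_mem j ⟨zero_mem _, ha⟩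
  smul_mem i j a x ha hx := ⟨M.smul_mem i j a x.1 ha hx.1, N.smul_mem i j a x.2 ha hx.2⟩

theorem isHomogeneous_range {M N : GrMod k Q} (f : M ⟶ N) :
    N.IsHomogeneous (LinearMap.range f.hom) := by
  rintro _ ⟨x, rfl⟩ j
  exact ⟨M.proj j x, hom_proj f j x⟩

variable (k Q) in
/-- The property of being finitely presented, for graded modules. -/
def isFinitelyPresented : ObjectProperty (GrMod k Q) :=
  fun M => Module.FinitePresentation (PathAlgebra k Q) M

end GrMod

/-- The category `gr(kQ)` of finitely presented graded left `kQ`-modules. -/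
abbrev FpGrMod (k : Type u) [Field k] (Q : Type v) [Quiver.{w} Q] [Fintype Q] :=
  (GrMod.isFinitelyPresented k Q).FullSubcategory

namespace FpGrMod

variable (k : Type u) [Field k] (Q : Type v) [Quiver.{w} Q] [Fintype Q]

/-- The morphisms of `gr(kQ)` whose kernel and cokernel are finite-dimensional, that is, belong
to the Serre subcategory `fdim(kQ)`. -/
def isoModFdim : MorphismProperty (FpGrMod k Q) := fun _ N f =>
  FiniteDimensional k (LinearMap.ker f.hom.hom) ∧
    FiniteDimensional k (N.obj ⧸ LinearMap.range f.hom.hom)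

variable {k Q}

theorem isoModFdim_iff {M N : FpGrMod k Q} (f : M ⟶ N) :
    isoModFdim k Q f ↔ FiniteDimensional k (LinearMap.ker f.hom.hom) ∧
      FiniteDimensional k (N.obj ⧸ LinearMap.range f.hom.hom) := Iff.rfl

section Linear

set_option linter.unusedSectionVars false

variable {R : Type*} [Ring R] [Algebra k R] {M N P : Type*}
  [AddCommGroup M] [AddCommGroup N] [AddCommGroup P] [Module k N] [Module k P]
  [Module R M] [Module R N] [Module R P] [IsScalarTower k R N]
  [IsScalarTower k R P] (f : M →ₗ[R] N) (g : N →ₗ[R] P)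

theorem finite_coker_comp (hf : FiniteDimensional k (N ⧸ LinearMap.range f))
    (hg : FiniteDimensional k (P ⧸ LinearMap.range g)) :
    FiniteDimensional k (P ⧸ LinearMap.range (g ∘ₗ f)) := by
  let α : (N ⧸ LinearMap.range f) →ₗ[k] (P ⧸ LinearMap.range (g ∘ₗ f)) :=
    (Submodule.mapQ _ _ g (by rintro _ ⟨x, rfl⟩; exact ⟨x, rfl⟩)).restrictScalars k
  let β : (P ⧸ LinearMap.range g) →ₗ[R]
      ((P ⧸ LinearMap.range (g ∘ₗ f)) ⧸ LinearMap.range (Submodule.mapQ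
        (LinearMap.range f) (LinearMap.range (g ∘ₗ f)) g
          (by rintro _ ⟨x, rfl⟩; exact ⟨x, rfl⟩))) :=
    Submodule.liftQ _ (Submodule.mkQ _ ∘ₗ Submodule.mkQ _) (by
      rintro _ ⟨x, rfl⟩
      simp only [LinearMap.mem_ker, LinearMap.comp_apply]
      exact (Submodule.Quotient.mk_eq_zero _).2 ⟨Submodule.Quotient.mk x, rfl⟩)
  have hβ : Function.Surjective (β.restrictScalars k) := by
    intro y
    obtain ⟨y, rfl⟩ := Submodule.mkQ_surjective _ y
    obtain ⟨y, rfl⟩ := Submodule.mkQ_surjective _ y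
    exact ⟨Submodule.Quotient.mk y, rfl⟩
  have : FiniteDimensional k (_ ⧸ LinearMap.range α) :=
    Module.Finite.of_surjective (β.restrictScalars k) hβ
  exact Module.Finite.of_submodule_quotient (LinearMap.range α)

variable [Module k M] [IsScalarTower k R M]

theorem finite_ker_comp (hf : FiniteDimensional k (LinearMap.ker f))
    (hg : FiniteDimensional k (LinearMap.ker g)) :
    FiniteDimensional k (LinearMap.ker (g ∘ₗ f)) := by
  let φ : LinearMap.ker (g ∘ₗ f) →ₗ[k] LinearMap.ker g :=
    (f.restrict (p := LinearMap.ker (g ∘ₗ f)) (q := LinearMap.ker g)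
      fun x hx => hx).restrictScalars k
  let ψ : LinearMap.ker φ →ₗ[k] LinearMap.ker f :=
    { toFun := fun x => ⟨x.1.1, congrArg Subtype.val x.2⟩
      map_add' := fun _ _ => rfl
      map_smul' := fun _ _ => rfl }
  have : FiniteDimensional k (LinearMap.ker φ) :=
    Module.Finite.of_injective ψ fun x y h =>
      Subtype.ext (Subtype.ext (congrArg (fun z => z.1) h))
  have : FiniteDimensional k (_ ⧸ LinearMap.ker φ) :=
    Module.Finite.equiv φ.quotKerEquivRange.symm
  exact Module.Finite.of_submodule_quotient (LinearMap.ker φ)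

theorem finite_ker_pushout (s : M →ₗ[R] N) (f : M →ₗ[R] P)
    (hs : FiniteDimensional k (LinearMap.ker s)) :
    FiniteDimensional k (LinearMap.ker
      ((LinearMap.range (s.prod (-f))).mkQ ∘ₗ LinearMap.inr R N P)) := by
  let φ : LinearMap.ker s →ₗ[k] LinearMap.ker
      ((LinearMap.range (s.prod (-f))).mkQ ∘ₗ LinearMap.inr R N P) :=
    ((-f).restrict (p := LinearMap.ker s) (q := LinearMap.ker
      ((LinearMap.range (s.prod (-f))).mkQ ∘ₗ LinearMap.inr R N P)) fun x hx =>
        (Submodule.Quotient.mk_eq_zero _).2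
          ⟨x, Prod.ext hx rfl⟩).restrictScalars k
  refine Module.Finite.of_surjective φ ?_
  rintro ⟨y, hy⟩
  obtain ⟨x, hx⟩ := (Submodule.Quotient.mk_eq_zero _).1 hy
  exact ⟨⟨x, congrArg Prod.fst hx⟩, Subtype.ext (congrArg Prod.snd hx)⟩

theorem finite_coker_pushout (s : M →ₗ[R] N) (f : M →ₗ[R] P)
    (hs : FiniteDimensional k (N ⧸ LinearMap.range s)) :
    FiniteDimensional k (((N × P) ⧸ LinearMap.range (s.prod (-f))) ⧸ LinearMap.range
      ((LinearMap.range (s.prod (-f))).mkQ ∘ₗ LinearMap.inr R N P)) := by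
  let φ : (N ⧸ LinearMap.range s) →ₗ[R]
      (((N × P) ⧸ LinearMap.range (s.prod (-f))) ⧸ LinearMap.range
        ((LinearMap.range (s.prod (-f))).mkQ ∘ₗ LinearMap.inr R N P)) :=
    Submodule.liftQ _ (Submodule.mkQ _ ∘ₗ Submodule.mkQ _ ∘ₗ LinearMap.inl R N P) (by
      rintro _ ⟨x, rfl⟩
      refine (Submodule.Quotient.mk_eq_zero _).2 ⟨f x, ?_⟩
      refine (Submodule.Quotient.eq _).2 ⟨-x, ?_⟩
      simp)
  refine Module.Finite.of_surjective (φ.restrictScalars k) ?_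
  intro y
  obtain ⟨y, rfl⟩ := Submodule.mkQ_surjective _ y
  obtain ⟨⟨y, z⟩, rfl⟩ := Submodule.mkQ_surjective _ y
  refine ⟨Submodule.Quotient.mk y, (Submodule.Quotient.eq _).2 ⟨-z, ?_⟩⟩
  change Submodule.Quotient.mk _ = Submodule.Quotient.mk _ - Submodule.Quotient.mk _
  rw [← Submodule.Quotient.mk_sub]
  simp

theorem fg_of_finite (N : Submodule R M) [FiniteDimensional k N] : N.FG :=
  have : Module.Finite R N := Module.Finite.of_restrictScalars_finite k R N
  Module.Finite.iff_fg.1 this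

end Linear

instance : (isoModFdim k Q).IsMultiplicative where
  id_mem _M := by
    have h₁ : LinearMap.ker (InducedCategory.Hom.hom (𝟙 _M)).hom = ⊥ := LinearMap.ker_id
    have h₂ : LinearMap.range (InducedCategory.Hom.hom (𝟙 _M)).hom = ⊤ := LinearMap.range_id
    rw [isoModFdim_iff, h₁, h₂]
    exact ⟨inferInstance, inferInstance⟩
  comp_mem f g hf hg :=
    ⟨finite_ker_comp f.hom.hom g.hom.hom hf.1 hg.1, finite_coker_comp f.hom.hom g.hom.hom hf.2 hg.2⟩

/-- The quotient of an object of `gr(kQ)` by a finitely generated homogeneous submodule. -/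
def quotient (M : FpGrMod k Q) (N : Submodule (PathAlgebra k Q) M.obj)
    (hN : M.obj.IsHomogeneous N) (hN' : N.FG) : FpGrMod k Q where
  obj := M.obj.quotient N hN
  property :=
    have : Module.FinitePresentation (PathAlgebra k Q) M.obj := M.property
    Module.finitePresentation_of_surjective N.mkQ N.mkQ_surjective (N.ker_mkQ.symm ▸ hN')

/-- The projection onto a quotient. -/
def quotientMap (M : FpGrMod k Q) (N : Submodule (PathAlgebra k Q) M.obj)
    (hN : M.obj.IsHomogeneous N) (hN' : N.FG) : M ⟶ M.quotient N hN hN' :=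
  ObjectProperty.homMk ⟨N.mkQ, fun _ x hx => ⟨x, hx, rfl⟩⟩

theorem fg_range {M N : FpGrMod k Q} (f : M.obj ⟶ N.obj) : (LinearMap.range f.hom).FG :=
  have : Module.FinitePresentation (PathAlgebra k Q) M.obj := M.property
  Module.Finite.iff_fg.1 inferInstance

/-- The product of two objects of `gr(kQ)`. -/
def prod (M N : FpGrMod k Q) : FpGrMod k Q where
  obj := M.obj.prod N.obj
  property :=
    have : Module.FinitePresentation (PathAlgebra k Q) M.obj := M.property
    have : Module.FinitePresentation (PathAlgebra k Q) N.obj := N.property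
    (inferInstance : Module.FinitePresentation (PathAlgebra k Q) (M.obj × N.obj))

instance : (isoModFdim k Q).HasLeftCalculusOfFractions where
  exists_leftFraction X Y φ := by
    let g : φ.X'.obj ⟶ (X.prod Y).obj :=
      { hom := φ.s.hom.hom.prod (-φ.f.hom.hom)
        map_mem := fun j x hx =>
          ⟨φ.s.hom.map_mem j x hx, neg_mem (φ.f.hom.map_mem j x hx)⟩ }
    let π := (X.prod Y).quotientMap _ (GrMod.isHomogeneous_range g) (fg_range g)
    let i₁ : X ⟶ X.prod Y :=
      ObjectProperty.homMk ⟨LinearMap.inl _ _ _, fun j x hx => ⟨hx, zero_mem _⟩⟩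
    let i₂ : Y ⟶ X.prod Y :=
      ObjectProperty.homMk ⟨LinearMap.inr _ _ _, fun j x hx => ⟨zero_mem _, hx⟩⟩
    refine ⟨⟨i₁ ≫ π, i₂ ≫ π, finite_ker_pushout φ.s.hom.hom φ.f.hom.hom φ.hs.1,
      finite_coker_pushout φ.s.hom.hom φ.f.hom.hom φ.hs.2⟩, ?_⟩
    apply ObjectProperty.hom_ext
    apply GrMod.hom_ext
    intro x
    refine (Submodule.Quotient.eq _).2 ⟨-x, ?_⟩
    refine Prod.ext ?_ ?_
    · change φ.s.hom.hom (-x) = 0 - φ.s.hom.hom x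
      simp
    · change (-φ.f.hom.hom) (-x) = φ.f.hom.hom x - 0
      simp
  ext X' X Y f₁ f₂ s hs h := by
    let d := (f₁ - f₂).hom
    have hd : ∀ x, d.hom (s.hom.hom x) = 0 := fun x => by
      have : (s ≫ (f₁ - f₂)) = 0 := by rw [Preadditive.comp_sub, h, sub_self]
      exact congrArg (fun f : X' ⟶ Y => f.hom.hom x) this
    have hfin : FiniteDimensional k (LinearMap.range d.hom) := by
      have := hs.2
      let φ := (LinearMap.range s.hom.hom).liftQ d.hom (by rintro _ ⟨x, rfl⟩; exact hd x)
      have hφ : LinearMap.range φ = LinearMap.range d.hom := Submodule.range_liftQ _ _ _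
      rw [← hφ]
      exact Module.Finite.of_surjective (φ.rangeRestrict.restrictScalars k)
        φ.surjective_rangeRestrict
    refine ⟨_, Y.quotientMap _ (GrMod.isHomogeneous_range d) (fg_range d), ⟨?_, ?_⟩, ?_⟩
    · change FiniteDimensional k (LinearMap.ker (LinearMap.range d.hom).mkQ)
      rw [Submodule.ker_mkQ]
      exact hfin
    · change FiniteDimensional k (_ ⧸ LinearMap.range (LinearMap.range d.hom).mkQ)
      rw [Submodule.range_mkQ]
      infer_instance
    · apply ObjectProperty.hom_ext
      apply GrMod.hom_ext
      intro x
      exact (Submodule.Quotient.eq _).2 ⟨x, rfl⟩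

end FpGrMod

/-- The quotient category `qgr(kQ) = gr(kQ)/fdim(kQ)`: the localization of `gr(kQ)` at the
morphisms whose kernel and cokernel are finite-dimensional. It is a preadditive category. -/
abbrev QgrCat (k : Type u) [Field k] (Q : Type v) [Quiver.{w} Q] [Fintype Q] :=
  (FpGrMod.isoModFdim k Q).Localization

/-- The quotient functor `π^* : gr(kQ) ⥤ qgr(kQ)`. -/
abbrev piStar (k : Type u) [Field k] (Q : Type v) [Quiver.{w} Q] [Fintype Q] :
    FpGrMod k Q ⥤ QgrCat k Q :=
  (FpGrMod.isoModFdim k Q).Q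

end

noncomputable section

/-! For a graded module M, consider in each degree j the map ⨁_a e_{s(a)}M_j → M_{j+1}, summed over
the arrows a with source s(a), that sends (y_a) to ∑ a·y_a. `ArrowSurjective` and `ArrowInjective`
say that this map is onto, respectively injective. For kQ itself it is injective in every degree,
because a path of positive length determines its last arrow; free modules and the P_i inherit this.

A module with finite-dimensional components that vanish in low degrees is finitely generated exactly
when the map is onto for all large j. Covering a finitely generated M by a graded free module and
chasing relations through the kernel, one finds that the kernel is arrow-surjective in high degrees
exactly when M is arrow-injective there. Hence M is finitely presented if and only if it is
arrow-injective in all high degrees (`finitePresentation_iff`). This criterion passes to finitely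
generated graded submodules, a form of coherence; no noetherian hypothesis is needed.

Where both conditions hold from degree n on, M_{≥n} is freely rebuilt from M_n = ⨁ e_iM_n, and so it
is a sum of copies of P_i(-n) (`exists_iso_sumP`). These are projective, so every surjection in
gr(kQ) splits after truncation, and short exact sequences follow.

For the quotient category, let f be a morphism of gr(kQ). Its image and cokernel are finitely
presented, so in high degrees the surjections onto them split, and f_{≥n} is von Neumann regular: f
g f = f for some g (`exists_truncMap_regular`). Truncation does not change the image under π^*, and
left fractions show that every morphism of qgr(kQ) is isomorphic, as an arrow, to one coming from
gr(kQ). So every morphism of qgr(kQ) is regular (`QgrCat.exists_regular`). Regular monomorphisms and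
epimorphisms in this sense split, and the last two claims follow without proving that qgr(kQ) is
abelian. -/

/-- All arrows of the quiver `Q`. -/
abbrev QuiverArrows (Q : Type v) [Quiver.{w} Q] : Type (max v w) :=
  Σ (i : Q) (j : Q), (i ⟶ j)

theorem finite_paths_of_length (Q : Type v) [Quiver.{w} Q] [Finite Q]
    [∀ i j : Q, Finite (i ⟶ j)] (n : ℕ) : {p : QuiverPaths Q | p.2.2.length = n}.Finite := by
  induction n with
  | zero =>
    refine (Set.finite_range fun i : Q => (⟨i, i, Quiver.Path.nil⟩ : QuiverPaths Q)).subset ?_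
    rintro ⟨a, b, p⟩ hp
    cases p with
    | nil => exact ⟨a, rfl⟩
    | cons p f => simp at hp
  | succ n ih =>
    refine Set.Finite.subset (Set.Finite.biUnion ih fun p _ =>
      Set.finite_range fun f : (Σ j, (p.2.1 ⟶ j)) =>
        (⟨p.1, f.1, p.2.2.cons f.2⟩ : QuiverPaths Q)) ?_
    rintro ⟨a, b, p⟩ hp
    cases p with
    | nil => simp at hp
    | cons p f =>
      simp only [Set.mem_ofPred_eq, Quiver.Path.length_cons, add_left_inj] at hp
      exact Set.mem_biUnion (x := ⟨a, _, p⟩) hp ⟨⟨_, f⟩, rfl⟩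

/-! ### Left multiplication by arrows in the path algebra -/

namespace PathAlgebra

variable (k : Type u) [Field k] {Q : Type v} [Quiver.{w} Q]

/-- The element of `kQ` given by an arrow. -/
def arrow (a : QuiverArrows Q) : PathAlgebra k Q := ofPath k ⟨a.1, a.2.1, a.2.2.toPath⟩

theorem arrow_mem_deg (a : QuiverArrows Q) : arrow k a ∈ deg k Q 1 := by
  simpa [Quiver.Path.length_toPath, arrow] using ofPath_mem_deg k Q ⟨a.1, a.2.1, a.2.2.toPath⟩

theorem arrow_mul_ofPath {i j l : Q} (f : j ⟶ l) (p : Quiver.Path i j) :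
    arrow k ⟨j, l, f⟩ * ofPath k ⟨i, j, p⟩ = ofPath k ⟨i, l, p.cons f⟩ := by
  rw [arrow, ofPath_mul_ofPath, mulPath_of_eq, Quiver.Path.comp_toPath_eq_cons]

theorem arrow_mul_ofPath_of_ne (a : QuiverArrows Q) (p : QuiverPaths Q) (h : p.2.1 ≠ a.1) :
    arrow k a * ofPath k p = 0 := by
  rw [arrow, ofPath_mul_ofPath, mulPath_of_ne _ _ h]

theorem e_mul_e_self (i : Q) : e k i * e k i = e k i := by
  classical
  exact (e_mul_ofPath i _).trans (if_pos rfl)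

theorem e_mul_e_of_ne {i j : Q} (h : i ≠ j) : e k i * e k j = 0 := by
  classical
  exact (e_mul_ofPath i _).trans (if_neg (Ne.symm h))

theorem arrow_mul_e (a : QuiverArrows Q) : arrow k a * e k a.1 = arrow k a := by
  classical
  exact (ofPath_mul_e _ _).trans (if_pos rfl)

theorem deg_eq_bot {j : ℤ} (hj : j < 0) : deg k Q j = ⊥ := by
  rw [deg, Submodule.span_eq_bot]
  rintro x ⟨p, hp, rfl⟩
  omega

open Classical in
/-- The linear map sending a path `ap` to `p`, and the paths whose last arrow is not `a` to
zero. -/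
def dropArrow (a : QuiverArrows Q) : PathAlgebra k Q →ₗ[k] PathAlgebra k Q :=
  (basis k).constr k fun p => match p with
    | ⟨_, _, .nil⟩ => 0
    | ⟨i, l, .cons (b := j) p f⟩ =>
      if (⟨j, l, f⟩ : QuiverArrows Q) = a then ofPath k ⟨i, j, p⟩ else 0

variable {k}

-- Left multiplication by an arrow appends it at the end of a path, and the last arrow of a path is
-- unique. So removing the last arrow separates the contributions of different arrows and inverts
-- multiplication by one arrow, up to the idempotent at its source.
open Classical in
theorem dropArrow_arrow_mul (a b : QuiverArrows Q) (x : PathAlgebra k Q) :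
    dropArrow k a (arrow k b * x) = if b = a then e k a.1 * x else 0 := by
  induction x using PathAlgebra.induction with
  | zero => simp [PathAlgebra.mul_zero']
  | add x y hx hy => simp only [PathAlgebra.mul_add', map_add, hx, hy]; split_ifs <;> simp
  | smul c x hx => simp only [PathAlgebra.mul_smul, map_smul, hx]; split_ifs <;> simp
  | path p =>
    obtain ⟨i, j, p⟩ := p
    by_cases h : j = b.1
    · obtain ⟨j', l, f⟩ := b
      obtain rfl : j = j' := h
      rw [arrow_mul_ofPath, dropArrow, ofPath, Module.Basis.constr_basis]
      dsimp only
      split_ifs with h'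
      · subst h'
        rw [e_mul_ofPath, if_pos rfl]
      · rfl
    · rw [arrow_mul_ofPath_of_ne k b _ h, map_zero]
      split_ifs with h'
      · subst h'
        rw [e_mul_ofPath, if_neg h]
      · rfl

end PathAlgebra

/-! ### Modules without relations between arrows -/

section ArrowIndependent

variable (k : Type u) [Field k] (Q : Type v) [Quiver.{w} Q] [Fintype Q]
  [Fintype (QuiverArrows Q)]

open PathAlgebra

/-- A module `X` over `kQ` is arrow-independent if its submodule `(kQ)_{≥ 1} X` is the direct sum
of copies of the spaces `e_i X`, one for each arrow starting at `i`. -/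
def ArrowIndependent (X : Type*) [AddCommGroup X] [Module (PathAlgebra k Q) X] : Prop :=
  ∀ y : QuiverArrows Q → X, ∑ a, arrow k a • y a = 0 → ∀ a, e k a.1 • y a = 0

/-- Applying `dropArrow` to a relation isolates one summand. This is the only place where the
freeness of the path algebra on its arrows enters. -/
theorem arrowIndependent_self : ArrowIndependent k Q (PathAlgebra k Q) := by
  classical
  intro y hy a
  have := congrArg (dropArrow k a) hy
  simpa [map_sum, dropArrow_arrow_mul] using this

variable {k Q}

theorem ArrowIndependent.of_injective {X Y : Type*} [AddCommGroup X]
    [Module (PathAlgebra k Q) X] [AddCommGroup Y] [Module (PathAlgebra k Q) Y]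
    (h : ArrowIndependent k Q Y) (f : X →ₗ[PathAlgebra k Q] Y) (hf : Function.Injective f) :
    ArrowIndependent k Q X := by
  intro y hy a
  apply hf
  have := h (fun a => f (y a)) (by simpa using congrArg f hy) a
  simpa using this

theorem ArrowIndependent.pi {ι : Type*} {X : ι → Type*} [∀ i, AddCommGroup (X i)]
    [∀ i, Module (PathAlgebra k Q) (X i)] (h : ∀ i, ArrowIndependent k Q (X i)) :
    ArrowIndependent k Q (∀ i, X i) := by
  intro y hy a
  funext i
  exact h i (fun a => y a i) (by simpa using congrFun hy i) a

end ArrowIndependent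

namespace GrMod

open PathAlgebra

variable {k : Type u} [Field k] {Q : Type v} [Quiver.{w} Q] [Fintype Q]

theorem eq_zero_of_proj (M : GrMod k Q) {x : M} (h : ∀ j, M.proj j x = 0) : x = 0 := by
  obtain ⟨s, hs⟩ := M.exists_sum_proj x
  rw [← hs s subset_rfl]
  exact Finset.sum_eq_zero fun j _ => h j

theorem proj_self (M : GrMod k Q) {j : ℤ} {x : M} (hx : x ∈ M.deg j) : M.proj j x = x :=
  (M.proj_of_mem j j hx).trans (if_pos rfl)

theorem e_smul_mem (M : GrMod k Q) (i : Q) {j : ℤ} {x : M} (hx : x ∈ M.deg j) :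
    e k i • x ∈ M.deg j := by
  simpa using M.smul_mem 0 j _ x (e_mem_deg k i) hx

theorem sum_e_smul (M : GrMod k Q) (x : M) : ∑ i : Q, e k i • x = x := by
  rw [← Finset.sum_smul, ← one_def, one_smul]

theorem arrow_smul_mem (M : GrMod k Q) (a : QuiverArrows Q) {j : ℤ} {x : M} (hx : x ∈ M.deg j) :
    arrow k a • x ∈ M.deg (j + 1) := by
  rw [add_comm]
  exact M.smul_mem 1 j _ x (arrow_mem_deg k a) hx

/-! ### Homogeneous generators and the size of graded components -/

section Generators

theorem exists_homogeneous_generators (M : GrMod k Q) [Module.Finite (PathAlgebra k Q) M] :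
    ∃ (r : ℕ) (g : Fin r → M) (δ : Fin r → ℤ), (∀ i, g i ∈ M.deg (δ i)) ∧
      Submodule.span (PathAlgebra k Q) (Set.range g) = ⊤ := by
  obtain ⟨G, hG⟩ := Module.Finite.fg_top (R := PathAlgebra k Q) (M := M)
  choose s hs using M.exists_sum_proj
  let ι := Σ x : G, s x
  let ε := Fintype.equivFin ι
  refine ⟨Fintype.card ι, fun i => M.proj (ε.symm i).2 (ε.symm i).1, fun i => (ε.symm i).2,
    fun i => M.proj_mem _ _, ?_⟩
  rw [eq_top_iff, ← hG, Submodule.span_le]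
  intro x hx
  rw [← hs x _ subset_rfl]
  exact sum_mem fun j hj => Submodule.subset_span ⟨ε ⟨⟨x, hx⟩, ⟨j, hj⟩⟩, by
    dsimp only; rw [Equiv.symm_apply_apply]⟩

variable (M : GrMod k Q) {ι : Type*} {g : ι → M} {δ : ι → ℤ}

/-- This turns generation over kQ into a k-linear statement in each degree. Vanishing in low
degrees, finite-dimensionality and arrow-surjectivity are all read off from it. -/
theorem deg_le_span_paths (hδ : ∀ i, g i ∈ M.deg (δ i))
    (hg : Submodule.span (PathAlgebra k Q) (Set.range g) = ⊤) (j : ℤ) :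
    M.deg j ≤ Submodule.span k
      {y | ∃ (i : ι) (p : QuiverPaths Q), p.2.2.length + δ i = j ∧ y = ofPath k p • g i} := by
  intro x hx
  -- Induction on the kQ-span passes through elements that are not homogeneous, so the claim is
  -- proved for the degree j projection of an arbitrary element, with j varying.
  rw [← M.proj_self hx]
  clear hx
  have hx : x ∈ Submodule.span (PathAlgebra k Q) (Set.range g) := hg ▸ trivial
  induction hx using Submodule.span_induction generalizing j with
  | zero => simp
  | add x y _ _ hx hy => rw [map_add]; exact add_mem (hx j) (hy j)
  | mem x h =>
    obtain ⟨i, rfl⟩ := h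
    rw [M.proj_of_mem _ _ (hδ i)]
    split_ifs with h
    · rw [← M.sum_e_smul (g i)]
      exact sum_mem fun l _ => Submodule.subset_span
        ⟨i, ⟨l, l, Quiver.Path.nil⟩, by simpa using h, rfl⟩
    · exact zero_mem _
  | smul a x _ hx =>
    induction a using PathAlgebra.induction with
    | zero => simp
    | add a b ha hb => rw [add_smul, map_add]; exact add_mem ha hb
    | smul c a ha => rw [smul_assoc, map_smul]; exact Submodule.smul_mem _ c ha
    | path p =>
      rw [M.proj_smul (ofPath_mem_deg k Q p)]
      have := hx (j - p.2.2.length)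
      generalize M.proj (j - p.2.2.length) x = z at this
      induction this using Submodule.span_induction with
      | zero => simp
      | add x y _ _ hx hy => rw [smul_add]; exact add_mem hx hy
      | smul c x _ hx =>
        rw [smul_comm]
        exact Submodule.smul_mem _ c hx
      | mem x h =>
        obtain ⟨i, q, hq, rfl⟩ := h
        rw [← mul_smul, ofPath_mul_ofPath]
        obtain ⟨b, c, p⟩ := p
        obtain ⟨a, b', q⟩ := q
        by_cases h : b' = b
        · subst h
          rw [mulPath_of_eq]
          refine Submodule.subset_span ⟨i, _, ?_, rfl⟩
          simp only [Quiver.Path.length_comp] at *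
          push_cast
          omega
        · rw [mulPath_of_ne _ _ h, zero_smul]
          exact zero_mem _

theorem deg_eq_bot_of_generators (hδ : ∀ i, g i ∈ M.deg (δ i))
    (hg : Submodule.span (PathAlgebra k Q) (Set.range g) = ⊤) {j : ℤ} (hj : ∀ i, j < δ i) :
    M.deg j = ⊥ := by
  refine eq_bot_iff.2 ((M.deg_le_span_paths hδ hg j).trans ?_)
  rw [Submodule.span_le]
  rintro _ ⟨i, p, hp, rfl⟩
  have := hj i
  omega

theorem exists_deg_eq_bot [Module.Finite (PathAlgebra k Q) M] :
    ∃ b : ℤ, ∀ j < b, M.deg j = ⊥ := by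
  obtain ⟨r, g, δ, hδ, hg⟩ := M.exists_homogeneous_generators
  obtain ⟨b, hb⟩ := (Set.finite_range δ).bddBelow
  exact ⟨b, fun j hj => M.deg_eq_bot_of_generators hδ hg fun i => hj.trans_le (hb ⟨i, rfl⟩)⟩

theorem finiteDimensional_deg [∀ i j : Q, Finite (i ⟶ j)] [Module.Finite (PathAlgebra k Q) M]
    (j : ℤ) : FiniteDimensional k (M.deg j) := by
  obtain ⟨r, g, δ, hδ, hg⟩ := M.exists_homogeneous_generators
  have hfin : {y | ∃ (i : Fin r) (p : QuiverPaths Q),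
      p.2.2.length + δ i = j ∧ y = ofPath k p • g i}.Finite := by
    -- If j < δ i there is no path to account for, and the value 0 of `toNat` merely enlarges the
    -- finite set.
    refine (Set.finite_iUnion fun i : Fin r => ((finite_paths_of_length Q (j - δ i).toNat).image
      fun p => ofPath k p • g i)).subset ?_
    rintro _ ⟨i, p, hp, rfl⟩
    exact Set.mem_iUnion.2 ⟨i, p, by simp only [Set.mem_ofPred_eq]; omega, rfl⟩
  have := FiniteDimensional.span_of_finite k hfin
  exact Submodule.finiteDimensional_of_le (M.deg_le_span_paths hδ hg j)

end Generators

/-! ### Generation and relations from one degree to the next -/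

section ArrowConditions

variable [Fintype (QuiverArrows Q)]

/-- The component of degree `j + 1` is generated by the component of degree `j`. -/
def ArrowSurjective (M : GrMod k Q) (j : ℤ) : Prop :=
  ∀ x ∈ M.deg (j + 1), ∃ y : QuiverArrows Q → M, (∀ a, y a ∈ M.deg j) ∧
    ∑ a, arrow k a • y a = x

/-- There are no linear relations between the products of arrows and elements of degree `j`. -/
def ArrowInjective (M : GrMod k Q) (j : ℤ) : Prop :=
  ∀ y : QuiverArrows Q → M, (∀ a, y a ∈ M.deg j) → ∑ a, arrow k a • y a = 0 →
    ∀ a, e k a.1 • y a = 0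

variable (M : GrMod k Q)

theorem _root_.ArrowIndependent.arrowInjective {M : GrMod k Q} (h : ArrowIndependent k Q M)
    (j : ℤ) : M.ArrowInjective j := fun y _ => h y

/-- When no generator lies above degree j, a path carrying a generator into degree j + 1 has
positive length, and its last arrow can be split off. -/
theorem arrowSurjective_of_generators {ι : Type*} {g : ι → M} {δ : ι → ℤ}
    (hδ : ∀ i, g i ∈ M.deg (δ i))
    (hg : Submodule.span (PathAlgebra k Q) (Set.range g) = ⊤) {j : ℤ} (hj : ∀ i, δ i ≤ j) :
    M.ArrowSurjective j := by
  classical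
  intro x hx
  have := M.deg_le_span_paths hδ hg _ hx
  clear hx
  induction this using Submodule.span_induction with
  | zero => exact ⟨0, fun a => zero_mem _, by simp⟩
  | add x x' _ _ hx hx' =>
    obtain ⟨y, hy, rfl⟩ := hx
    obtain ⟨y', hy', rfl⟩ := hx'
    exact ⟨y + y', fun a => add_mem (hy a) (hy' a), by simp [smul_add, Finset.sum_add_distrib]⟩
  | smul c x _ hx =>
    obtain ⟨y, hy, rfl⟩ := hx
    refine ⟨fun a => c • y a, fun a => Submodule.smul_mem _ c (hy a), ?_⟩
    rw [Finset.smul_sum]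
    exact Finset.sum_congr rfl fun a _ => smul_comm _ _ _
  | mem x h =>
    obtain ⟨i, ⟨b, c, p⟩, hp, rfl⟩ := h
    cases p with
    | nil =>
      have := hj i
      simp only [Quiver.Path.length_nil] at hp
      omega
    | @cons d _ p f =>
      refine ⟨Pi.single ⟨d, c, f⟩ (ofPath k ⟨b, d, p⟩ • g i), fun a => ?_, ?_⟩
      · by_cases h : a = ⟨d, c, f⟩
        · subst h
          rw [Pi.single_eq_same]
          have := M.smul_mem _ _ _ _ (ofPath_mem_deg k Q ⟨b, d, p⟩) (hδ i)
          simp only [Quiver.Path.length_cons] at hp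
          rwa [show (p.length : ℤ) + δ i = j by omega] at this
        · rw [Pi.single_eq_of_ne h]
          exact zero_mem _
      · rw [Finset.sum_eq_single ⟨d, c, f⟩]
        · rw [Pi.single_eq_same, ← mul_smul, arrow_mul_ofPath]
        · intro a _ h
          rw [Pi.single_eq_of_ne h, smul_zero]
        · simp

theorem exists_arrowSurjective [Module.Finite (PathAlgebra k Q) M] :
    ∃ N : ℤ, ∀ j, N ≤ j → M.ArrowSurjective j := by
  obtain ⟨r, g, δ, hδ, hg⟩ := M.exists_homogeneous_generators
  obtain ⟨b, hb⟩ := (Set.finite_range δ).bddAbove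
  exact ⟨b, fun j hj => M.arrowSurjective_of_generators hδ hg fun i => (hb ⟨i, rfl⟩).trans hj⟩

theorem deg_le_of_arrowSurjective {N : ℤ} (hM : ∀ j, N ≤ j → M.ArrowSurjective j)
    (S : Submodule (PathAlgebra k Q) M) (hS : ∀ x ∈ M.deg N, x ∈ S) (j : ℤ) (hj : N ≤ j) :
    ∀ x ∈ M.deg j, x ∈ S := by
  induction j, hj using Int.leInduction with
  | base => exact hS
  | succ j hj ih =>
    intro x hx
    obtain ⟨y, hy, rfl⟩ := hM j hj x hx
    exact sum_mem fun a _ => S.smul_mem _ (ih _ (hy a))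

/-- Bases of the components in degrees b to N generate: nothing lies below b, and everything above N
is reached from degree N by arrows. This is how kernels and truncations are shown to be finitely
generated. -/
theorem finite_of_arrowSurjective {b N : ℤ} (hb : ∀ j < b, M.deg j = ⊥)
    (hfin : ∀ j, FiniteDimensional k (M.deg j)) (hM : ∀ j, N ≤ j → M.ArrowSurjective j) :
    Module.Finite (PathAlgebra k Q) M := by
  have hfg : (⨆ j ∈ Finset.Icc b N,
      Submodule.span (PathAlgebra k Q) (M.deg j : Set M)).FG := by
    refine Submodule.fg_biSup _ _ fun j _ => ?_
    obtain ⟨G, hG⟩ := Module.Finite.iff_fg.1 (hfin j)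
    refine ⟨G, le_antisymm (Submodule.span_mono ?_) ?_⟩
    · rw [← hG]; exact Submodule.subset_span
    · rw [Submodule.span_le, ← hG]
      exact Submodule.span_le_restrictScalars k _ _
  refine ⟨?_⟩
  convert hfg
  refine (eq_top_iff.2 fun x _ => ?_).symm
  have hle : ∀ j, j ≤ N → ∀ x ∈ M.deg j, x ∈ (⨆ j ∈ Finset.Icc b N,
      Submodule.span (PathAlgebra k Q) (M.deg j : Set M)) := by
    intro j hj x hx
    by_cases h : j < b
    · rw [hb j h] at hx
      rw [(Submodule.mem_bot k).1 hx]
      exact zero_mem _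
    · exact Submodule.mem_iSup_of_mem j (Submodule.mem_iSup_of_mem
        (Finset.mem_Icc.2 ⟨not_lt.1 h, hj⟩) (Submodule.subset_span hx))
  induction x using M.induction with
  | zero => exact zero_mem _
  | add x y hx hy => exact add_mem (hx trivial) (hy trivial)
  | mem j x hx =>
    rcases le_total j N with h | h
    · exact hle j h x hx
    · exact M.deg_le_of_arrowSurjective hM _ (hle N le_rfl) j h x hx

end ArrowConditions

end GrMod

/-! ### Kernels and transfer of the arrow conditions -/

namespace GrMod

open PathAlgebra

variable {k : Type u} [Field k] {Q : Type v} [Quiver.{w} Q] [Fintype Q]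

theorem exists_mem_deg_of_surjective {M N : GrMod k Q} (f : M ⟶ N)
    (hf : Function.Surjective f.hom) {j : ℤ} {y : N} (hy : y ∈ N.deg j) :
    ∃ x ∈ M.deg j, f.hom x = y := by
  obtain ⟨x, rfl⟩ := hf y
  exact ⟨M.proj j x, M.proj_mem j x, by rw [hom_proj, N.proj_self hy]⟩

theorem isHomogeneous_ker {M N : GrMod k Q} (f : M ⟶ N) :
    M.IsHomogeneous (LinearMap.ker f.hom) := by
  intro x hx j
  rw [LinearMap.mem_ker] at hx ⊢
  rw [hom_proj, hx, map_zero]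

/-- The kernel of a homomorphism as a graded module. -/
abbrev ker {M N : GrMod k Q} (f : M ⟶ N) : GrMod k Q :=
  M.ofSubmodule (LinearMap.ker f.hom) (isHomogeneous_ker f)

/-- The inclusion of a homogeneous submodule. -/
def ofSubmoduleι (M : GrMod k Q) (N : Submodule (PathAlgebra k Q) M) (hN : M.IsHomogeneous N) :
    M.ofSubmodule N hN ⟶ M :=
  ⟨N.subtype, fun _ _ hx => hx⟩

theorem ofSubmoduleι_injective (M : GrMod k Q) (N : Submodule (PathAlgebra k Q) M)
    (hN : M.IsHomogeneous N) : Function.Injective (M.ofSubmoduleι N hN).hom :=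
  N.injective_subtype

theorem finiteDimensional_deg_of_injective {M N : GrMod k Q} (f : M ⟶ N)
    (hf : Function.Injective f.hom) (j : ℤ) [FiniteDimensional k (N.deg j)] :
    FiniteDimensional k (M.deg j) :=
  Module.Finite.of_injective ((f.hom.restrictScalars k).restrict (f.map_mem j))
    fun _ _ h => Subtype.ext (hf (congrArg Subtype.val h))

theorem deg_eq_bot_of_injective {M N : GrMod k Q} (f : M ⟶ N)
    (hf : Function.Injective f.hom) {j : ℤ} (hj : N.deg j = ⊥) : M.deg j = ⊥ := by
  refine eq_bot_iff.2 fun x hx => (Submodule.mem_bot k).2 (hf ?_)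
  have := f.map_mem j x hx
  rw [hj, Submodule.mem_bot] at this
  rw [this, map_zero]

/-- A bijective homomorphism is an isomorphism. -/
def isoOfBijective {M N : GrMod k Q} (f : M ⟶ N) (hf : Function.Bijective f.hom) : M ≅ N where
  hom := f
  inv :=
    { hom := (LinearEquiv.ofBijective f.hom hf).symm
      map_mem := fun j y hy => by
        obtain ⟨x, hx, rfl⟩ := exists_mem_deg_of_surjective f hf.2 hy
        simpa using hx }
  hom_inv_id := by
    ext x
    exact (LinearEquiv.ofBijective f.hom hf).symm_apply_apply x
  inv_hom_id := by
    ext x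
    exact (LinearEquiv.ofBijective f.hom hf).apply_symm_apply x

theorem iso_hom_bijective {M N : GrMod k Q} (f : M ≅ N) : Function.Bijective f.hom.hom := by
  refine Function.bijective_iff_has_inverse.2 ⟨f.inv.hom, fun x => ?_, fun x => ?_⟩
  · exact congrArg (fun g : M ⟶ M => g.hom x) f.hom_inv_id
  · exact congrArg (fun g : N ⟶ N => g.hom x) f.inv_hom_id

section ArrowConditions

variable [Fintype (QuiverArrows Q)] {M N : GrMod k Q} {j : ℤ}

theorem ArrowInjective.of_injective (h : N.ArrowInjective j) (f : M ⟶ N)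
    (hf : Function.Injective f.hom) : M.ArrowInjective j := by
  intro y hy hsum a
  apply hf
  have := h (fun a => f.hom (y a)) (fun a => f.map_mem j _ (hy a))
    (by simpa using congrArg f.hom hsum) a
  simpa using this

/-- A relation in N lifts to M up to an error in degree j + 1 of the kernel. The error is itself a
combination of arrows applied to kernel elements of degree j, so subtracting these from the lifts
gives a genuine relation in M. -/
theorem ArrowInjective.of_surjective (h : M.ArrowInjective j) (f : M ⟶ N)
    (hf : Function.Surjective f.hom) (hker : (ker f).ArrowSurjective j) :
    N.ArrowInjective j := by
  intro y hy hsum a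
  choose z hz hzy using fun a => exists_mem_deg_of_surjective f hf (hy a)
  have hmem : ∑ a, arrow k a • z a ∈ M.deg (j + 1) :=
    sum_mem fun a _ => M.arrow_smul_mem a (hz a)
  obtain ⟨t, ht, hsum'⟩ := hker ⟨∑ a, arrow k a • z a, by
    rw [LinearMap.mem_ker, map_sum]
    simpa [hzy] using hsum⟩ hmem
  have key := h (fun a => z a - (t a).1) (fun a => sub_mem (hz a) (ht a)) (by
    have := congrArg (ofSubmoduleι M _ (isHomogeneous_ker f)).hom hsum'
    rw [map_sum] at this
    simp only [smul_sub, Finset.sum_sub_distrib]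
    rw [sub_eq_zero]
    exact this.symm) a
  have key' := congrArg f.hom key
  have h0 : f.hom (t a).1 = 0 := (t a).2
  simpa [hzy, h0] using key'

/-- Write a kernel element as ∑ a·y_a in M. Its image is a relation in N, so f kills each
e_{s(a)}y_a, and these may replace the y_a because a = a·e_{s(a)}. -/
theorem ArrowSurjective.ker (h : M.ArrowSurjective j) (f : M ⟶ N) (hN : N.ArrowInjective j) :
    (GrMod.ker f).ArrowSurjective j := by
  rintro ⟨x, hx⟩ hxj
  obtain ⟨y, hy, rfl⟩ := h x hxj
  have key := hN (fun a => f.hom (y a)) (fun a => f.map_mem j _ (hy a))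
    (by simpa using LinearMap.mem_ker.1 hx)
  refine ⟨fun a => ⟨e k a.1 • y a, by rw [LinearMap.mem_ker, map_smul, key a]⟩,
    fun a => M.e_smul_mem _ (hy a), ?_⟩
  apply M.ofSubmoduleι_injective _ (isHomogeneous_ker f)
  simp only [map_sum]
  refine Finset.sum_congr rfl fun a _ => ?_
  change arrow k a • (e k a.1 • y a) = _
  rw [← mul_smul, arrow_mul_e]

/-- A homomorphism that is bijective in degree `j` is bijective in degree `j + 1`. -/
theorem bijOn_succ (f : M ⟶ N) (hM : M.ArrowSurjective j) (hN : N.ArrowSurjective j)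
    (hN' : N.ArrowInjective j) (hinj : ∀ x ∈ M.deg j, f.hom x = 0 → x = 0)
    (hsurj : ∀ y ∈ N.deg j, ∃ x, f.hom x = y) :
    (∀ x ∈ M.deg (j + 1), f.hom x = 0 → x = 0) ∧ ∀ y ∈ N.deg (j + 1), ∃ x, f.hom x = y := by
  refine ⟨fun x hx h => ?_, fun y hy => ?_⟩
  · obtain ⟨y, hy, rfl⟩ := hM x hx
    have key := hN' (fun a => f.hom (y a)) (fun a => f.map_mem j _ (hy a)) (by simpa using h)
    refine Finset.sum_eq_zero fun a _ => ?_
    rw [← arrow_mul_e, mul_smul, hinj (e k a.1 • y a) (M.e_smul_mem _ (hy a)), smul_zero]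
    rw [map_smul, key a]
  · obtain ⟨z, hz, rfl⟩ := hN y hy
    choose x hx using fun a => hsurj (z a) (hz a)
    exact ⟨∑ a, arrow k a • x a, by simp [hx]⟩

/-- Bijectivity propagates upwards from the lowest degree n, so an isomorphism can be tested on a
single component. -/
theorem bijective_of_deg (f : M ⟶ N) {n : ℤ} (hMn : ∀ j < n, M.deg j = ⊥)
    (hNn : ∀ j < n, N.deg j = ⊥) (hM : ∀ j, n ≤ j → M.ArrowSurjective j)
    (hN : ∀ j, n ≤ j → N.ArrowSurjective j) (hN' : ∀ j, n ≤ j → N.ArrowInjective j)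
    (hinj : ∀ x ∈ M.deg n, f.hom x = 0 → x = 0) (hsurj : ∀ y ∈ N.deg n, ∃ x, f.hom x = y) :
    Function.Bijective f.hom := by
  have key : ∀ j, (∀ x ∈ M.deg j, f.hom x = 0 → x = 0) ∧ ∀ y ∈ N.deg j, ∃ x, f.hom x = y := by
    intro j
    rcases lt_or_ge j n with h | h
    · rw [hMn j h, hNn j h]
      exact ⟨fun x hx _ => by simpa using hx, fun y hy => ⟨0, by simpa using Eq.symm hy⟩⟩
    · induction j, h using Int.leInduction with
      | base => exact ⟨hinj, hsurj⟩
      | succ j hj ih => exact bijOn_succ f (hM j hj) (hN j hj) (hN' j hj) ih.1 ih.2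
  refine ⟨(injective_iff_map_eq_zero f.hom).2 fun x hx => M.eq_zero_of_proj fun j =>
    (key j).1 _ (M.proj_mem j x) (by rw [hom_proj, hx, map_zero]), fun y => ?_⟩
  induction y using N.induction with
  | zero => exact ⟨0, map_zero _⟩
  | add x y hx hy =>
    obtain ⟨x, rfl⟩ := hx
    obtain ⟨y, rfl⟩ := hy
    exact ⟨x + y, map_add _ _ _⟩
  | mem j y hy => exact (key j).2 y hy

end ArrowConditions

/-! ### Finite presentation as absence of relations in high degrees -/

section FinitePresentation

theorem exists_free_cover (M : GrMod k Q) [Module.Finite (PathAlgebra k Q) M] :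
    ∃ (ι : Type v) (_ : Fintype ι) (δ : ι → ℤ)
      (f : directSum (fun i : ι => (regular k Q).shift (δ i)) ⟶ M),
      Function.Surjective f.hom := by
  obtain ⟨r, g, δ, hδ, hg⟩ := M.exists_homogeneous_generators
  -- Shifting by -δ i places the unit of the i-th copy of kQ in degree δ i. The lift only adjusts
  -- the universe of the index type to the one `directSum` expects.
  refine ⟨ULift (Fin r), inferInstance, fun i => -δ i.down,
    ⟨Fintype.linearCombination (PathAlgebra k Q) fun i : ULift.{v} (Fin r) => g i.down, ?_⟩, ?_⟩
  · intro j x hx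
    change ∑ i : ULift.{v} (Fin r), (show PathAlgebra k Q from x i) • g i.down ∈ M.deg j
    refine sum_mem fun i _ => ?_
    have := M.smul_mem _ _ _ _ (hx i trivial) (hδ i.down)
    rwa [show -δ i.down + j + δ i.down = j by omega] at this
  · refine LinearMap.range_eq_top.1 ((Fintype.range_linearCombination _ _).trans ?_)
    rw [← hg]
    congr 1
    exact ULift.down_surjective.range_comp g

variable [Fintype (QuiverArrows Q)] [∀ i j : Q, Finite (i ⟶ j)]

/-- For a free cover F of M, finite presentation means that the kernel is finitely generated, that
is, arrow-surjective in high degrees. Since F is arrow-injective everywhere and arrow-surjective in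
high degrees, this amounts to arrow-injectivity of M in high degrees. -/
theorem finitePresentation_iff (M : GrMod k Q) [Module.Finite (PathAlgebra k Q) M] :
    Module.FinitePresentation (PathAlgebra k Q) M ↔
      ∃ N : ℤ, ∀ j, N ≤ j → M.ArrowInjective j := by
  obtain ⟨ι, _, δ, f, hf⟩ := M.exists_free_cover
  let F := directSum (fun i : ι => (regular k Q).shift (δ i))
  change F ⟶ M at f
  have : Module.Finite (PathAlgebra k Q) F :=
    inferInstanceAs (Module.Finite (PathAlgebra k Q) (ι → PathAlgebra k Q))
  have : Module.Free (PathAlgebra k Q) F :=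
    inferInstanceAs (Module.Free (PathAlgebra k Q) (ι → PathAlgebra k Q))
  have hF : ArrowIndependent k Q F :=
    ArrowIndependent.pi (X := fun _ : ι => PathAlgebra k Q) fun _ => arrowIndependent_self k Q
  constructor
  · intro h
    have hfg := Module.FinitePresentation.fg_ker f.hom hf
    have : Module.Finite (PathAlgebra k Q) (ker f) := Module.Finite.iff_fg.2 hfg
    obtain ⟨N, hN⟩ := (ker f).exists_arrowSurjective
    exact ⟨N, fun j hj => (hF.arrowInjective j).of_surjective f hf (hN j hj)⟩
  · rintro ⟨N, hN⟩
    obtain ⟨N', hN'⟩ := F.exists_arrowSurjective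
    obtain ⟨b, hb⟩ := F.exists_deg_eq_bot
    have hι := F.ofSubmoduleι_injective _ (isHomogeneous_ker f)
    have : Module.Finite (PathAlgebra k Q) (ker f) :=
      (ker f).finite_of_arrowSurjective (b := b) (N := max N N')
        (fun j hj => deg_eq_bot_of_injective _ hι (hb j hj))
        (fun j => have := F.finiteDimensional_deg j; finiteDimensional_deg_of_injective _ hι j)
        (fun j hj => (hN' j (le_of_max_le_right hj)).ker f (hN j (le_of_max_le_left hj)))
    exact Module.finitePresentation_of_free_of_surjective f.hom hf (Module.Finite.iff_fg.1 this)

end FinitePresentation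

/-! ### Truncations -/

section Trunc

variable (M : GrMod k Q) (n : ℤ)

theorem mem_truncSubmodule_of_mem_deg {j : ℤ} {x : M} (hx : x ∈ M.deg j) (hj : n ≤ j) :
    x ∈ M.truncSubmodule n := fun i hi => by
  rw [M.proj_of_mem j i hx, if_neg (by omega)]

theorem trunc_deg_eq_bot {j : ℤ} (hj : j < n) : (M.trunc n).deg j = ⊥ := by
  refine eq_bot_iff.2 fun x hx => (Submodule.mem_bot k).2 (Subtype.ext ?_)
  have h : M.proj j x.1 = 0 := x.2 j hj
  exact (M.proj_self (x := x.1) hx).symm.trans h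

/-- The inclusion `M_{≥n} → M`. -/
def truncι : M.trunc n ⟶ M :=
  M.ofSubmoduleι _ _

theorem truncι_injective : Function.Injective (M.truncι n).hom :=
  M.ofSubmoduleι_injective _ _

theorem exists_truncι {j : ℤ} {x : M} (hx : x ∈ M.deg j) (hj : n ≤ j) :
    ∃ y ∈ (M.trunc n).deg j, (M.truncι n).hom y = x :=
  ⟨⟨x, M.mem_truncSubmodule_of_mem_deg n hx hj⟩, hx, rfl⟩

theorem truncMap_ι {M N : GrMod k Q} (f : M ⟶ N) (n : ℤ) :
    truncMap f n ≫ N.truncι n = M.truncι n ≫ f := rfl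

theorem truncMap_surjective {M N : GrMod k Q} (f : M ⟶ N) (hf : Function.Surjective f.hom)
    (n : ℤ) : Function.Surjective (truncMap f n).hom := by
  intro y
  induction y using (N.trunc n).induction with
  | zero => exact ⟨0, map_zero _⟩
  | add x y hx hy =>
    obtain ⟨x, rfl⟩ := hx
    obtain ⟨y, rfl⟩ := hy
    exact ⟨x + y, map_add _ _ _⟩
  | mem j y hy =>
    rcases lt_or_ge j n with h | h
    · rw [trunc_deg_eq_bot N n h, Submodule.mem_bot] at hy
      exact ⟨0, by rw [hy, map_zero]⟩
    · obtain ⟨x, hx, hxy⟩ := exists_mem_deg_of_surjective f hf (y := y.1) hy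
      exact ⟨⟨x, M.mem_truncSubmodule_of_mem_deg n hx h⟩, Subtype.ext hxy⟩

/-- The quotient is spanned by the components in degrees b ≤ j < n, where M vanishes below b; each
is finite-dimensional. -/
theorem finiteDimensional_quotient_truncSubmodule [∀ i j : Q, Finite (i ⟶ j)]
    [Module.Finite (PathAlgebra k Q) M] :
    FiniteDimensional k (M ⧸ M.truncSubmodule n) := by
  obtain ⟨b, hb⟩ := M.exists_deg_eq_bot
  have hfin (j : ℤ) := M.finiteDimensional_deg j
  let f : (∀ j : Finset.Ico b n, M.deg j) →ₗ[k] (M ⧸ M.truncSubmodule n) :=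
    (M.truncSubmodule n).mkQ.restrictScalars k ∘ₗ
      ∑ j : Finset.Ico b n, (M.deg j).subtype ∘ₗ LinearMap.proj j
  refine Module.Finite.of_surjective f fun y => ?_
  obtain ⟨x, rfl⟩ := (M.truncSubmodule n).mkQ_surjective y
  refine ⟨fun j => ⟨M.proj j x, M.proj_mem j x⟩, ?_⟩
  refine (Submodule.Quotient.eq _).2 fun i hi => ?_
  have : (∑ j : Finset.Ico b n, (M.deg j).subtype ∘ₗ LinearMap.proj (φ := fun j :
      Finset.Ico b n => M.deg j) j) (fun j => ⟨M.proj j x, M.proj_mem j x⟩) =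
      ∑ j ∈ Finset.Ico b n, M.proj j x := by
    rw [LinearMap.sum_apply]
    exact Finset.sum_coe_sort (Finset.Ico b n) fun j => M.proj j x
  rw [this, map_sub, map_sum, sub_eq_zero]
  rw [Finset.sum_congr rfl fun j _ => M.proj_of_mem j i (M.proj_mem j x), Finset.sum_ite_eq']
  split_ifs with h
  · rfl
  · have h' : i < b := by
      by_contra h''
      exact h (Finset.mem_Ico.2 ⟨not_lt.1 h'', hi⟩)
    have := M.proj_mem i x
    rw [hb i h', Submodule.mem_bot] at this
    exact this.symm

variable [Fintype (QuiverArrows Q)] {M n}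

theorem ArrowSurjective.trunc {j : ℤ} (h : M.ArrowSurjective j) (hj : n ≤ j) :
    (M.trunc n).ArrowSurjective j := by
  intro x hx
  obtain ⟨y, hy, hxy⟩ := h x.1 hx
  choose z hz hzy using fun a => M.exists_truncι n (hy a) hj
  refine ⟨z, hz, M.truncι_injective n ?_⟩
  simp only [map_sum, map_smul, hzy]
  exact hxy

theorem ArrowInjective.trunc {j : ℤ} (h : M.ArrowInjective j) : (M.trunc n).ArrowInjective j :=
  h.of_injective _ (M.truncι_injective n)

theorem ArrowInjective.of_trunc {j : ℤ} (h : (M.trunc n).ArrowInjective j) (hj : n ≤ j) :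
    M.ArrowInjective j := by
  intro y hy hsum a
  choose z hz hzy using fun a => M.exists_truncι n (hy a) hj
  have := h z hz (M.truncι_injective n (by simpa [hzy] using hsum)) a
  simpa [hzy] using congrArg (M.truncι n).hom this

variable [∀ i j : Q, Finite (i ⟶ j)] (M n)

/-- Since kQ need not be left noetherian, finite generation of a submodule is not automatic. Here it
comes from arrow-surjectivity in high degrees, which truncation preserves. -/
theorem finite_trunc [Module.Finite (PathAlgebra k Q) M] :
    Module.Finite (PathAlgebra k Q) (M.trunc n) := by
  obtain ⟨N, hN⟩ := M.exists_arrowSurjective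
  exact (M.trunc n).finite_of_arrowSurjective (b := n) (N := max n N)
    (fun j hj => M.trunc_deg_eq_bot n hj)
    (fun j => have := M.finiteDimensional_deg j
      finiteDimensional_deg_of_injective _ (M.truncι_injective n) j)
    (fun j hj => (hN j (le_of_max_le_right hj)).trunc (le_of_max_le_left hj))

theorem finitePresentation_trunc [h : Module.FinitePresentation (PathAlgebra k Q) M] :
    Module.FinitePresentation (PathAlgebra k Q) (M.trunc n) := by
  have := M.finite_trunc n
  obtain ⟨N, hN⟩ := M.finitePresentation_iff.1 h
  exact (M.trunc n).finitePresentation_iff.2 ⟨N, fun j hj => (hN j hj).trunc⟩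

end Trunc

end GrMod

namespace PathAlgebra

variable {k : Type u} [Field k] {Q : Type v} [Quiver.{w} Q]

/-- Degree 0 of kQ is spanned by the orthogonal idempotents e_j, so the lowest component of P_i is
the line through e_i. -/
theorem exists_mul_e_eq_smul {i : Q} {x : PathAlgebra k Q} (hx : x ∈ deg k Q 0) :
    ∃ c : k, x * e k i = c • e k i := by
  classical
  induction hx using Submodule.span_induction with
  | zero => exact ⟨0, by rw [PathAlgebra.zero_mul', zero_smul]⟩
  | add x y _ _ hx hy =>
    obtain ⟨c, hc⟩ := hx
    obtain ⟨d, hd⟩ := hy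
    exact ⟨c + d, by rw [PathAlgebra.add_mul', hc, hd, add_smul]⟩
  | smul c x _ hx =>
    obtain ⟨d, hd⟩ := hx
    exact ⟨c * d, by rw [PathAlgebra.smul_mul, hd, mul_smul]⟩
  | mem x h =>
    obtain ⟨⟨a, b, p⟩, hp, rfl⟩ := h
    cases p with
    | nil =>
      rw [ofPath_mul_e]
      split_ifs with h
      · subst h
        exact ⟨1, (one_smul _ _).symm⟩
      · exact ⟨0, (zero_smul _ _).symm⟩
    | cons p f =>
      simp only [Quiver.Path.length_cons] at hp
      omega

end PathAlgebra

namespace GrMod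

open PathAlgebra

variable {k : Type u} [Field k] {Q : Type v} [Quiver.{w} Q] [Fintype Q]

/-! ### Epimorphisms of graded modules -/

section EpiMono

theorem epi_of_surjective {M N : GrMod k Q} (f : M ⟶ N) (hf : Function.Surjective f.hom) :
    Epi f where
  left_cancellation g h hgh := by
    ext y
    obtain ⟨x, rfl⟩ := hf y
    exact congrArg (fun l : M ⟶ _ => l.hom x) hgh

theorem surjective_of_epi {M N : GrMod k Q} (f : M ⟶ N) [Epi f] :
    Function.Surjective f.hom := by
  let π : N ⟶ N.quotient _ (isHomogeneous_range f) :=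
    ⟨(LinearMap.range f.hom).mkQ, fun _ x hx => ⟨x, hx, rfl⟩⟩
  have hπ : π = 0 := by
    rw [← cancel_epi f]
    ext x
    exact (Submodule.Quotient.mk_eq_zero _).2 ⟨x, rfl⟩
  intro y
  exact (Submodule.Quotient.mk_eq_zero _).1
    (congrArg (fun g : N ⟶ N.quotient _ (isHomogeneous_range f) => g.hom y) hπ)

end EpiMono

/-! ### Shifts and finite direct sums in coordinates -/

section DirectSum

/-- The identity map from a shift to the original module. -/
def unshift (M : GrMod k Q) (n : ℤ) : M.shift n →ₗ[PathAlgebra k Q] M :=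
  (LinearMap.id : M →ₗ[PathAlgebra k Q] M)

/-- The identity map from a module to a shift. -/
def toShift (M : GrMod k Q) (n : ℤ) : M →ₗ[PathAlgebra k Q] M.shift n :=
  (LinearMap.id : M →ₗ[PathAlgebra k Q] M)

theorem unshift_injective (M : GrMod k Q) (n : ℤ) : Function.Injective (M.unshift n) :=
  fun _ _ h => h

theorem unshift_toShift (M : GrMod k Q) (n : ℤ) (x : M) : M.unshift n (M.toShift n x) = x := rfl

theorem mem_deg_shift {M : GrMod k Q} {n j : ℤ} {x : M.shift n} :
    x ∈ (M.shift n).deg j ↔ M.unshift n x ∈ M.deg (n + j) := Iff.rfl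

variable {ι : Type v} [Fintype ι]

/-- The projections of a direct sum. -/
def directSumProj (M : ι → GrMod k Q) (a : ι) : directSum M →ₗ[PathAlgebra k Q] M a :=
  (LinearMap.proj a : (∀ a, M a) →ₗ[PathAlgebra k Q] M a)

open Classical in
/-- The inclusions into a direct sum. -/
def directSumSingle (M : ι → GrMod k Q) (a : ι) : M a →ₗ[PathAlgebra k Q] directSum M :=
  (LinearMap.single (PathAlgebra k Q) (fun a => M a) a : M a →ₗ[PathAlgebra k Q] (∀ a, M a))

theorem directSum_ext {M : ι → GrMod k Q} {x y : directSum M}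
    (h : ∀ a, directSumProj M a x = directSumProj M a y) : x = y :=
  funext h

theorem mem_deg_directSum {M : ι → GrMod k Q} {j : ℤ} {x : directSum M} :
    x ∈ (directSum M).deg j ↔ ∀ a, directSumProj M a x ∈ (M a).deg j :=
  ⟨fun h a => h a trivial, fun h a _ => h a⟩

theorem directSumProj_single_self (M : ι → GrMod k Q) (a : ι) (x : M a) :
    directSumProj M a (directSumSingle M a x) = x := by
  classical
  exact Pi.single_eq_same (M := fun a => M a) a x

theorem directSumProj_single_of_ne (M : ι → GrMod k Q) {a b : ι} (h : b ≠ a) (x : M a) :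
    directSumProj M b (directSumSingle M a x) = 0 := by
  classical
  exact Pi.single_eq_of_ne (M := fun a => M a) h x

theorem arrowIndependent_directSum [Fintype (QuiverArrows Q)] {M : ι → GrMod k Q}
    (h : ∀ a, ArrowIndependent k Q (M a)) : ArrowIndependent k Q (directSum M) :=
  ArrowIndependent.pi (X := fun a => M a) h

end DirectSum

/-! ### Sums of the projectives P_i, all generated in one degree -/

section SumP

variable (k) in
/-- The element of `kQ` underlying an element of `P_i`. -/
def valP (i : Q) : P k i →ₗ[PathAlgebra k Q] PathAlgebra k Q :=
  (Submodule.span (PathAlgebra k Q) {e k i}).subtype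

theorem valP_injective (i : Q) : Function.Injective (valP k i) :=
  Submodule.injective_subtype _

variable (k) in
/-- The generator `e_i` of `P_i`. -/
def genP (i : Q) : P k i :=
  (⟨e k i, Submodule.mem_span_singleton_self _⟩ : Submodule.span (PathAlgebra k Q) {e k i})

theorem valP_genP (i : Q) : valP k i (genP k i) = e k i := rfl

theorem mem_deg_P {i : Q} {j : ℤ} {x : P k i} :
    x ∈ (P k i).deg j ↔ valP k i x ∈ PathAlgebra.deg k Q j := Iff.rfl

theorem valP_mul_e {i : Q} (x : P k i) : valP k i x * e k i = valP k i x := by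
  obtain ⟨a, ha⟩ := Submodule.mem_span_singleton.1 (Subtype.prop (p := fun y => y ∈
    Submodule.span (PathAlgebra k Q) {e k i}) x)
  change a * e k i = valP k i x at ha
  rw [← ha, mul_assoc, e_mul_e_self]

variable {ι : Type v} [Fintype ι]

variable (k) in
/-- The graded module `⨁ P_{s(a)}(-n)`. -/
abbrev sumP (s : ι → Q) (n : ℤ) : GrMod k Q :=
  directSum fun a => (P k (s a)).shift (-n)

variable (k) in
/-- The coordinates of an element of `⨁ P_{s(a)}(-n)`, as elements of `kQ`. -/
def coordSumP (s : ι → Q) (n : ℤ) (a : ι) : sumP k s n →ₗ[PathAlgebra k Q] PathAlgebra k Q :=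
  valP k (s a) ∘ₗ (P k (s a)).unshift (-n) ∘ₗ directSumProj _ a

theorem coordSumP_apply (s : ι → Q) (n : ℤ) (a : ι) (x : sumP k s n) :
    coordSumP k s n a x = valP k (s a) ((P k (s a)).unshift (-n) (directSumProj _ a x)) := rfl

variable (s : ι → Q) {n : ℤ}

theorem sumP_ext {x y : sumP k s n} (h : ∀ a, coordSumP k s n a x = coordSumP k s n a y) :
    x = y :=
  directSum_ext fun a => unshift_injective _ _ (valP_injective (s a) (h a))

variable {s} in
theorem mem_deg_sumP {j : ℤ} {x : sumP k s n} :
    x ∈ (sumP k s n).deg j ↔ ∀ a, coordSumP k s n a x ∈ PathAlgebra.deg k Q (-n + j) :=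
  mem_deg_directSum.trans (forall_congr' fun _ => mem_deg_shift.trans mem_deg_P)

theorem sumP_deg_eq_bot {j : ℤ} (hj : j < n) : (sumP k s n).deg j = ⊥ := by
  refine eq_bot_iff.2 fun x hx => (Submodule.mem_bot k).2 (sumP_ext s fun a => ?_)
  have := mem_deg_sumP.1 hx a
  rw [deg_eq_bot k (by omega), Submodule.mem_bot] at this
  rw [this, map_zero]

variable (n) in
theorem arrowIndependent_sumP [Fintype (QuiverArrows Q)] :
    ArrowIndependent k Q (sumP k s n) :=
  arrowIndependent_directSum fun a => ((arrowIndependent_self k Q).of_injective _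
    (valP_injective (s a))).of_injective _ (unshift_injective _ (-n))

theorem coordSumP_mul_e (a : ι) (x : sumP k s n) :
    coordSumP k s n a x * e k (s a) = coordSumP k s n a x := by
  rw [coordSumP_apply, valP_mul_e]

variable (k n) in
/-- The generators of `⨁ P_{s(a)}(-n)`. -/
def genSumP (a : ι) : sumP k s n :=
  directSumSingle (fun a => (P k (s a)).shift (-n)) a ((P k (s a)).toShift (-n) (genP k (s a)))

theorem coordSumP_gen_self (a : ι) : coordSumP k s n a (genSumP k s n a) = e k (s a) := by
  rw [coordSumP_apply, genSumP, directSumProj_single_self, unshift_toShift, valP_genP]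

theorem coordSumP_gen_of_ne {a b : ι} (h : b ≠ a) :
    coordSumP k s n b (genSumP k s n a) = 0 := by
  rw [coordSumP_apply, genSumP, directSumProj_single_of_ne _ h, map_zero, map_zero]

theorem genSumP_mem_deg (a : ι) : genSumP k s n a ∈ (sumP k s n).deg n := by
  refine mem_deg_sumP.2 fun b => ?_
  rw [neg_add_cancel]
  by_cases h : b = a
  · subst h
    rw [coordSumP_gen_self]
    exact e_mem_deg k _
  · rw [coordSumP_gen_of_ne s h]
    exact zero_mem _

theorem sum_smul_genSumP (x : sumP k s n) :
    ∑ a, coordSumP k s n a x • genSumP k s n a = x := by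
  refine sumP_ext s fun b => ?_
  simp only [map_sum, map_smul]
  rw [Finset.sum_eq_single b]
  · rw [coordSumP_gen_self, smul_eq_mul, coordSumP_mul_e]
  · intro a _ h
    rw [coordSumP_gen_of_ne s h.symm, smul_zero]
  · simp

variable (n) in
theorem span_genSumP :
    Submodule.span (PathAlgebra k Q) (Set.range (genSumP k s n)) = ⊤ := by
  refine eq_top_iff.2 fun x _ => ?_
  rw [← sum_smul_genSumP s x]
  exact sum_mem fun a _ => Submodule.smul_mem _ _ (Submodule.subset_span ⟨a, rfl⟩)

theorem e_smul_genSumP (a : ι) : e k (s a) • genSumP k s n a = genSumP k s n a := by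
  refine sumP_ext s fun b => ?_
  rw [map_smul]
  by_cases h : b = a
  · subst h
    rw [coordSumP_gen_self, smul_eq_mul, e_mul_e_self]
  · rw [coordSumP_gen_of_ne s h, smul_zero]

variable {s} in
theorem sumP_hom_ext {M : GrMod k Q} {f g : sumP k s n ⟶ M}
    (h : ∀ a, f.hom (genSumP k s n a) = g.hom (genSumP k s n a)) : f = g :=
  Hom.ext (LinearMap.ext_on_range (span_genSumP s n) h)

variable {M : GrMod k Q} (x : ι → M)

variable (k) in
/-- The homomorphism from `⨁ P_{s(a)}(-n)` determined by elements of degree `n`. -/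
def descSumP (hx : ∀ a, x a ∈ M.deg n) : sumP k s n ⟶ M where
  hom := ∑ a, LinearMap.toSpanSingleton (PathAlgebra k Q) M (x a) ∘ₗ coordSumP k s n a
  map_mem j y hy := by
    rw [LinearMap.sum_apply]
    refine sum_mem fun a _ => ?_
    have := M.smul_mem _ _ _ _ (mem_deg_sumP.1 hy a) (hx a)
    rwa [show -n + j + n = j by omega] at this

theorem descSumP_apply (hx : ∀ a, x a ∈ M.deg n) (y : sumP k s n) :
    (descSumP k s x hx).hom y = ∑ a, coordSumP k s n a y • x a :=
  LinearMap.sum_apply _ _ _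

/-- The prescribed x a need not be fixed by e_{s(a)}: the homomorphism sees only its part at that
vertex. This spares a correction when lifting generators. -/
theorem descSumP_gen (hx : ∀ a, x a ∈ M.deg n) (a : ι) :
    (descSumP k s x hx).hom (genSumP k s n a) = e k (s a) • x a := by
  rw [descSumP_apply, Finset.sum_eq_single a]
  · rw [coordSumP_gen_self]
  · intro b _ h
    rw [coordSumP_gen_of_ne s h, zero_smul]
  · simp

/-- Lift the images of the generators to homogeneous elements of degree n. The factor e_{s(a)} that
appears is absorbed, since each generator is fixed by it. -/
instance projective_sumP : Projective (sumP k s n) where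
  factors {M N} f g _ := by
    have hg := surjective_of_epi g
    choose x hx hxg using fun a =>
      exists_mem_deg_of_surjective g hg (f.map_mem n _ (genSumP_mem_deg s a))
    refine ⟨descSumP k s x hx, sumP_hom_ext fun a => ?_⟩
    rw [comp_hom, LinearMap.comp_apply, descSumP_gen, map_smul, hxg, ← map_smul, e_smul_genSumP]

theorem arrowSurjective_sumP [Fintype (QuiverArrows Q)] {j : ℤ} (hj : n ≤ j) :
    (sumP k s n).ArrowSurjective j :=
  arrowSurjective_of_generators _ (genSumP_mem_deg s) (span_genSumP s n) fun _ => hj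

end SumP

/-! ### High truncations are sums of the P_i(-n) -/

section Structure

-- Bases of the pieces e_iT_n are put together along T_n = ⨁ e_iT_n. Independence is recorded vertex
-- by vertex, because multiplication by e_i separates the pieces anyway.
open Classical in
theorem exists_basis_deg (T : GrMod k Q) (n : ℤ) [FiniteDimensional k (T.deg n)] :
    ∃ (m : Q → ℕ) (x : (i : Q) × Fin (m i) → T), (∀ a, x a ∈ T.deg n) ∧
      (∀ a j, e k j • x a = if j = a.1 then x a else 0) ∧
      (∀ i, LinearIndependent k fun l => x ⟨i, l⟩) ∧
      T.deg n ≤ Submodule.span k (Set.range x) := by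
  let V (i : Q) : Submodule k T := (T.deg n).map (Algebra.lsmul k k T (e k i))
  have hV (i : Q) : ∀ x ∈ V i, x ∈ T.deg n ∧ ∀ j, e k j • x = if j = i then x else 0 := by
    rintro _ ⟨y, hy, rfl⟩
    refine ⟨T.e_smul_mem i hy, fun j => ?_⟩
    change e k j • e k i • y = if j = i then e k i • y else 0
    rw [← mul_smul]
    split_ifs with h
    · rw [h, e_mul_e_self]
    · rw [e_mul_e_of_ne k h, zero_smul]
  have hb (i : Q) : ∃ (m : ℕ) (b : Fin m → T), (∀ l, b l ∈ V i) ∧ LinearIndependent k b ∧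
      V i ≤ Submodule.span k (Set.range b) := by
    let b := Module.finBasis k (V i)
    refine ⟨_, fun l => (b l).1, fun l => (b l).2,
      b.linearIndependent.map' (V i).subtype (V i).ker_subtype, fun x hx => ?_⟩
    have h := congrArg (V i).subtype (b.sum_repr ⟨x, hx⟩)
    simp only [map_sum, map_smul] at h
    change _ = x at h
    rw [← h]
    exact sum_mem fun l _ => Submodule.smul_mem _ _ (Submodule.subset_span ⟨l, rfl⟩)
  choose m b hbV hli hspan using hb
  refine ⟨m, fun a => b a.1 a.2, fun a => (hV a.1 _ (hbV _ _)).1, fun a => (hV a.1 _ (hbV _ _)).2,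
    hli, fun y hy => ?_⟩
  rw [← T.sum_e_smul y]
  refine sum_mem fun i _ => Submodule.span_mono ?_ (hspan i ⟨y, hy, rfl⟩)
  rintro _ ⟨l, rfl⟩
  exact ⟨⟨i, l⟩, rfl⟩

variable [Fintype (QuiverArrows Q)]

/-- Send the generators to a basis of T_n adapted to the vertices. The map is bijective in degree n,
and the arrow conditions extend this to all degrees; the multiplicity of P_i is the dimension of
e_iT_n. -/
theorem exists_iso_sumP (T : GrMod k Q) {n : ℤ} [FiniteDimensional k (T.deg n)]
    (hTn : ∀ j < n, T.deg j = ⊥) (hT : ∀ j, n ≤ j → T.ArrowSurjective j)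
    (hT' : ∀ j, n ≤ j → T.ArrowInjective j) :
    ∃ m : Q → ℕ, Nonempty (T ≅ sumP k (fun a : (i : Q) × Fin (m i) => a.1) n) := by
  classical
  obtain ⟨m, x, hx, hex, hli, hspan⟩ := T.exists_basis_deg n
  let s : (i : Q) × Fin (m i) → Q := fun a => a.1
  let Φ := descSumP k s x hx
  refine ⟨m, ⟨(isoOfBijective Φ (bijective_of_deg Φ (n := n) (fun j hj => sumP_deg_eq_bot _ hj) hTn
    (fun j hj => arrowSurjective_sumP _ hj) hT hT' ?_ ?_)).symm⟩⟩
  · intro y hy hy0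
    -- In degree n of the shifted sum every coordinate has degree 0 in kQ, hence is a scalar
    -- multiple of its idempotent.
    have hc : ∀ a, ∃ c : k, coordSumP k s n a y = c • e k a.1 := fun a => by
      have := mem_deg_sumP.1 hy a
      rw [neg_add_cancel] at this
      obtain ⟨c, hc⟩ := exists_mul_e_eq_smul (i := a.1) this
      exact ⟨c, (coordSumP_mul_e s a y).symm.trans hc⟩
    choose c hc using hc
    have hsum : ∑ a, c a • x a = 0 := by
      rw [← hy0, descSumP_apply]
      refine Finset.sum_congr rfl fun a _ => ?_
      rw [hc, smul_assoc, hex, if_pos rfl]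
    have hc0 : ∀ a, c a = 0 := by
      rintro ⟨i, l⟩
      refine Fintype.linearIndependent_iff.1 (hli i) (fun l => c ⟨i, l⟩) ?_ l
      -- Multiplication by e_i retains only the terms at the vertex i, where the chosen elements are
      -- independent.
      have h := congrArg (fun z => e k i • z) hsum
      simp only [Finset.smul_sum, smul_zero, Fintype.sum_sigma] at h
      rw [Finset.sum_eq_single i] at h
      · rw [← h]
        refine Finset.sum_congr rfl fun l _ => ?_
        rw [smul_comm, hex, if_pos rfl]
      · intro j _ hj
        refine Finset.sum_eq_zero fun l _ => ?_
        rw [smul_comm, hex, if_neg hj.symm, smul_zero]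
      · simp
    refine sumP_ext s fun a => ?_
    rw [hc a, hc0 a, zero_smul, map_zero]
  · intro y hy
    have hy' := hspan hy
    clear hy
    induction hy' using Submodule.span_induction with
    | zero => exact ⟨0, map_zero _⟩
    | add y z _ _ hy hz =>
      obtain ⟨y, rfl⟩ := hy
      obtain ⟨z, rfl⟩ := hz
      exact ⟨y + z, map_add _ _ _⟩
    | smul c y _ hy =>
      obtain ⟨y, rfl⟩ := hy
      exact ⟨c • y, LinearMap.map_smul_of_tower _ _ _⟩
    | mem y hy =>
      obtain ⟨a, rfl⟩ := hy
      exact ⟨genSumP k s n a, by rw [descSumP_gen, hex, if_pos rfl]⟩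

variable [∀ i j : Q, Finite (i ⟶ j)]

theorem exists_trunc_iso (M : GrMod k Q) [h : Module.FinitePresentation (PathAlgebra k Q) M] :
    ∃ n₀ : ℤ, ∀ n, n₀ ≤ n → ∃ m : Q → ℕ,
      Nonempty (M.trunc n ≅ sumP k (fun a : (i : Q) × Fin (m i) => a.1) n) := by
  obtain ⟨N, hN⟩ := M.exists_arrowSurjective
  obtain ⟨N', hN'⟩ := M.finitePresentation_iff.1 h
  refine ⟨max N N', fun n hn => ?_⟩
  have := M.finiteDimensional_deg n
  have := finiteDimensional_deg_of_injective _ (M.truncι_injective n) n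
  exact (M.trunc n).exists_iso_sumP (fun j hj => M.trunc_deg_eq_bot n hj)
    (fun j hj => (hN j (by omega)).trunc hj) (fun j hj => (hN' j (by omega)).trunc)

theorem exists_projective_trunc (M : GrMod k Q)
    [Module.FinitePresentation (PathAlgebra k Q) M] :
    ∃ n₀ : ℤ, ∀ n, n₀ ≤ n → Projective (M.trunc n) := by
  obtain ⟨n₀, hn₀⟩ := M.exists_trunc_iso
  refine ⟨n₀, fun n hn => ?_⟩
  obtain ⟨m, ⟨e⟩⟩ := hn₀ n hn
  exact Projective.of_iso e.symm inferInstance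

/-- A single n suffices: the sum of the P_i is arrow-independent, and M agrees with M_{≥n} in all
degrees ≥ n. -/
theorem finitePresentation_of_trunc_iso (M : GrMod k Q) [Module.Finite (PathAlgebra k Q) M]
    {n : ℤ} {ι : Type v} [Fintype ι] {s : ι → Q} (f : M.trunc n ≅ sumP k s n) :
    Module.FinitePresentation (PathAlgebra k Q) M :=
  M.finitePresentation_iff.2 ⟨n, fun j hj =>
    (((arrowIndependent_sumP s n).arrowInjective j).of_injective f.hom
      (iso_hom_bijective f).1).of_trunc hj⟩

/-- The truncated target is projective in high degrees, and truncation preserves surjections;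
nothing is required of M. -/
theorem exists_section_truncMap {M N : GrMod k Q}
    [Module.FinitePresentation (PathAlgebra k Q) N] (g : M ⟶ N)
    (hg : Function.Surjective g.hom) :
    ∃ n₀ : ℤ, ∀ n, n₀ ≤ n → ∃ s : N.trunc n ⟶ M.trunc n, s ≫ truncMap g n = 𝟙 _ := by
  obtain ⟨n₀, hn₀⟩ := N.exists_projective_trunc
  refine ⟨n₀, fun n hn => ?_⟩
  have := hn₀ n hn
  have := epi_of_surjective _ (truncMap_surjective g hg n)
  exact ⟨Projective.factorThru (𝟙 _) (truncMap g n), Projective.factorThru_comp _ _⟩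

end Structure

end GrMod

/-! ### Splittings and regularity after truncation -/

namespace GrMod

open PathAlgebra

variable {k : Type u} [Field k] {Q : Type v} [Quiver.{w} Q] [Fintype Q]

theorem exists_lift_of_injective {L M T : GrMod k Q} (f : L ⟶ M)
    (hf : Function.Injective f.hom) (h : T ⟶ M) (hh : ∀ x, h.hom x ∈ LinearMap.range f.hom) :
    ∃ r : T ⟶ L, r ≫ f = h := by
  have key (x : T) : f.hom ((LinearEquiv.ofInjective f.hom hf).symm ⟨h.hom x, hh x⟩) = h.hom x :=
    congrArg Subtype.val ((LinearEquiv.ofInjective f.hom hf).apply_symm_apply ⟨h.hom x, hh x⟩)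
  refine ⟨⟨(LinearEquiv.ofInjective f.hom hf).symm.toLinearMap ∘ₗ h.hom.codRestrict _ hh,
    fun j x hx => ?_⟩, GrMod.hom_ext key⟩
  -- The inverse of f on its image preserves degrees, because f is injective and commutes with the
  -- projections.
  have : L.proj j ((LinearEquiv.ofInjective f.hom hf).symm ⟨h.hom x, hh x⟩) =
      (LinearEquiv.ofInjective f.hom hf).symm ⟨h.hom x, hh x⟩ := by
    apply hf
    rw [hom_proj, key, M.proj_self (h.map_mem j x hx)]
  change (LinearEquiv.ofInjective f.hom hf).symm ⟨h.hom x, hh x⟩ ∈ L.deg j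
  rw [← this]
  exact L.proj_mem j _

theorem truncMap_injective {L M : GrMod k Q} (f : L ⟶ M) (hf : Function.Injective f.hom)
    (n : ℤ) : Function.Injective (truncMap f n).hom := fun _ _ h =>
  Subtype.ext (hf (congrArg Subtype.val h))

theorem mem_range_truncMap {L M : GrMod k Q} (f : L ⟶ M) (hf : Function.Injective f.hom)
    {n : ℤ} (x : M.trunc n) (hx : (M.truncι n).hom x ∈ LinearMap.range f.hom) :
    x ∈ LinearMap.range (truncMap f n).hom := by
  obtain ⟨y, hy⟩ := hx
  refine ⟨⟨y, fun j hj => hf ?_⟩, M.truncι_injective n hy⟩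
  rw [hom_proj, hy, map_zero]
  exact x.2 j hj

theorem exists_lift_truncMap {L M N T : GrMod k Q} (f : L ⟶ M) (hf : Function.Injective f.hom)
    (g : M ⟶ N) (hfg : ∀ x, g.hom x = 0 → x ∈ LinearMap.range f.hom) (n : ℤ)
    (h : T ⟶ M.trunc n) (hh : h ≫ truncMap g n = 0) :
    ∃ r : T ⟶ L.trunc n, r ≫ truncMap f n = h :=
  exists_lift_of_injective _ (truncMap_injective f hf n) h fun x =>
    mem_range_truncMap f hf _ (hfg _
      (congrArg (fun l : T ⟶ N.trunc n => (N.truncι n).hom (l.hom x)) hh))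

theorem exists_splitting_truncFunctor [∀ i j : Q, Finite (i ⟶ j)] {S : ShortComplex (GrMod k Q)}
    [Module.FinitePresentation (PathAlgebra k Q) S.X₃] (hf : Function.Injective S.f.hom)
    (hfg : Function.Exact S.f.hom S.g.hom) (hg : Function.Surjective S.g.hom) :
    ∃ n₀ : ℤ, ∀ n, n₀ ≤ n → Nonempty (S.map (truncFunctor k Q n)).Splitting := by
  have := Fintype.ofFinite (QuiverArrows Q)
  obtain ⟨n₀, hn₀⟩ := exists_section_truncMap S.g hg
  refine ⟨n₀, fun n hn => ?_⟩
  obtain ⟨s, hs⟩ := hn₀ n hn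
  have hzero : truncMap S.f n ≫ truncMap S.g n = 0 := (S.map (truncFunctor k Q n)).zero
  -- With s a section of g, the endomorphism 1 - sg is killed by g, so it factors through the kernel
  -- L_{≥n} and yields the retraction.
  obtain ⟨r, hr⟩ := exists_lift_truncMap S.f hf S.g (fun x hx => (hfg x).1 hx) n
    (𝟙 _ - truncMap S.g n ≫ s) (by simp [Preadditive.sub_comp, hs])
  have hmono {T : GrMod k Q} {a b : T ⟶ S.X₁.trunc n}
      (h : a ≫ truncMap S.f n = b ≫ truncMap S.f n) : a = b := by
    ext x
    exact truncMap_injective S.f hf n (congrArg (fun l : T ⟶ _ => l.hom x) h)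
  refine ⟨{ r := r, s := s, f_r := hmono ?_, s_g := hs, id := ?_ }⟩
  · change (truncMap S.f n ≫ r) ≫ truncMap S.f n = 𝟙 _ ≫ truncMap S.f n
    rw [Category.assoc, hr, Preadditive.comp_sub, reassoc_of% hzero]
    simp
  · change r ≫ truncMap S.f n + truncMap S.g n ≫ s = 𝟙 _
    rw [hr, sub_add_cancel]

/-- With B the image of f and C its cokernel, both finitely presented, the surjections M → B and N →
C have sections in high degrees. The second makes B_{≥n} a retract of N_{≥n}; projecting onto B_{≥n}
and then applying the section into M_{≥n} gives the quasi-inverse. -/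
theorem exists_truncMap_regular [∀ i j : Q, Finite (i ⟶ j)] {M N : GrMod k Q}
    [hM : Module.FinitePresentation (PathAlgebra k Q) M]
    [hN : Module.FinitePresentation (PathAlgebra k Q) N] (f : M ⟶ N) :
    ∃ (n : ℤ) (g : N.trunc n ⟶ M.trunc n),
      truncMap f n ≫ g ≫ truncMap f n = truncMap f n := by
  have := Fintype.ofFinite (QuiverArrows Q)
  let B := N.ofSubmodule _ (isHomogeneous_range f)
  let ι : B ⟶ N := N.ofSubmoduleι _ _
  let p : M ⟶ B := ⟨f.hom.rangeRestrict, f.map_mem⟩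
  have hp : Function.Surjective p.hom := f.hom.surjective_rangeRestrict
  have hpι : p ≫ ι = f := rfl
  have : Module.Finite (PathAlgebra k Q) B := Module.Finite.of_surjective p.hom hp
  -- Coherence: B is finitely generated as a quotient of M, and arrow-injective in high degrees as a
  -- submodule of N.
  have hB : Module.FinitePresentation (PathAlgebra k Q) B := by
    obtain ⟨n, hn⟩ := N.finitePresentation_iff.1 hN
    exact B.finitePresentation_iff.2 ⟨n, fun j hj =>
      (hn j hj).of_injective ι (N.ofSubmoduleι_injective _ _)⟩
  let C := N.quotient _ (isHomogeneous_range f)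
  let q : N ⟶ C := ⟨(LinearMap.range f.hom).mkQ, fun _ x hx => ⟨x, hx, rfl⟩⟩
  have hq : Function.Surjective q.hom := (LinearMap.range f.hom).mkQ_surjective
  have hC : Module.FinitePresentation (PathAlgebra k Q) C :=
    Module.finitePresentation_of_surjective q.hom hq
      ((LinearMap.range f.hom).ker_mkQ.symm ▸ Module.Finite.iff_fg.1
        (Module.Finite.of_surjective p.hom hp))
  obtain ⟨n₁, h₁⟩ := exists_section_truncMap p hp
  obtain ⟨n₂, h₂⟩ := exists_section_truncMap q hq
  obtain ⟨s, hs⟩ := h₁ (max n₁ n₂) (le_max_left _ _)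
  obtain ⟨t, ht⟩ := h₂ (max n₁ n₂) (le_max_right _ _)
  have hfq : truncMap f (max n₁ n₂) ≫ truncMap q (max n₁ n₂) = 0 := by
    ext x
    exact Subtype.ext ((Submodule.Quotient.mk_eq_zero _).2 ⟨x.1, rfl⟩)
  obtain ⟨r, hr⟩ := exists_lift_truncMap ι (N.ofSubmoduleι_injective _ _) q
    (fun x hx => ⟨⟨x, (Submodule.Quotient.mk_eq_zero _).1 hx⟩, rfl⟩) (max n₁ n₂)
    (𝟙 _ - truncMap q _ ≫ t) (by simp [Preadditive.sub_comp, ht])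
  refine ⟨max n₁ n₂, r ≫ s, ?_⟩
  have hf : truncMap f (max n₁ n₂) = truncMap p _ ≫ truncMap ι _ := rfl
  conv_lhs => rw [Category.assoc, hf, reassoc_of% hs, ← hf, hr, Preadditive.comp_sub,
    reassoc_of% hfq]
  simp

end GrMod

/-! ### Truncation becomes invisible in the quotient category -/

namespace FpGrMod

variable {k : Type u} [Field k] {Q : Type v} [Quiver.{w} Q] [Fintype Q]
  [∀ i j : Q, Finite (i ⟶ j)]

/-- The truncation `M_{≥n}` of a finitely presented module. -/
def trunc (M : FpGrMod k Q) (n : ℤ) : FpGrMod k Q where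
  obj := M.obj.trunc n
  property :=
    have := Fintype.ofFinite (QuiverArrows Q)
    have : Module.FinitePresentation (PathAlgebra k Q) M.obj := M.property
    M.obj.finitePresentation_trunc n

/-- The inclusion `M_{≥n} → M`. -/
def truncι (M : FpGrMod k Q) (n : ℤ) : M.trunc n ⟶ M :=
  ObjectProperty.homMk (M.obj.truncι n)

theorem isoModFdim_truncι (M : FpGrMod k Q) (n : ℤ) : isoModFdim k Q (M.truncι n) := by
  have : Module.FinitePresentation (PathAlgebra k Q) M.obj := M.property
  have h₁ : LinearMap.ker (M.truncι n).hom.hom = ⊥ :=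
    LinearMap.ker_eq_bot.2 (M.obj.truncι_injective n)
  have h₂ : LinearMap.range (M.truncι n).hom.hom = M.obj.truncSubmodule n :=
    Submodule.range_subtype _
  rw [isoModFdim_iff, h₁, h₂]
  exact ⟨inferInstance, M.obj.finiteDimensional_quotient_truncSubmodule n⟩

instance (M : FpGrMod k Q) (n : ℤ) : IsIso ((piStar k Q).map (M.truncι n)) :=
  Localization.inverts _ (isoModFdim k Q) _ (M.isoModFdim_truncι n)

end FpGrMod

/-! ### Von Neumann regularity of qgr(kQ) -/

section Regular

variable {k : Type u} [Field k] {Q : Type v} [Quiver.{w} Q] [Fintype Q]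
  [∀ i j : Q, Finite (i ⟶ j)]

/-- The inclusions of the truncations become invertible under π^*, so a quasi-inverse of f_{≥n} is
carried to one of π^*f. -/
theorem exists_regular_piStar_map {M N : FpGrMod k Q} (f : M ⟶ N) :
    ∃ g, (piStar k Q).map f ≫ g ≫ (piStar k Q).map f = (piStar k Q).map f := by
  have : Module.FinitePresentation (PathAlgebra k Q) M.obj := M.property
  have : Module.FinitePresentation (PathAlgebra k Q) N.obj := N.property
  obtain ⟨n, g, hg⟩ := GrMod.exists_truncMap_regular f.hom
  let f' : M.trunc n ⟶ N.trunc n := ObjectProperty.homMk (GrMod.truncMap f.hom n)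
  let g' : N.trunc n ⟶ M.trunc n := ObjectProperty.homMk g
  have hg' : f' ≫ g' ≫ f' = f' := ObjectProperty.hom_ext _ hg
  have hf : f' ≫ N.truncι n = M.truncι n ≫ f :=
    ObjectProperty.hom_ext _ (GrMod.truncMap_ι f.hom n)
  let π := piStar k Q
  have hf₁ : inv (π.map (M.truncι n)) ≫ π.map f' = π.map f ≫ inv (π.map (N.truncι n)) := by
    rw [IsIso.inv_comp_eq, ← Category.assoc, IsIso.eq_comp_inv, ← π.map_comp, ← π.map_comp, hf]
  refine ⟨inv (π.map (N.truncι n)) ≫ π.map g' ≫ π.map (M.truncι n), ?_⟩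
  change π.map f ≫ (inv (π.map (N.truncι n)) ≫ π.map g' ≫ π.map (M.truncι n)) ≫ π.map f = π.map f
  simp only [Category.assoc]
  rw [← reassoc_of% hf₁, ← π.map_comp, ← hf, ← π.map_comp, ← π.map_comp, reassoc_of% hg', hf,
    π.map_comp, IsIso.inv_hom_id_assoc]

/-- By the calculus of left fractions, f is isomorphic in the arrow category to some π^*φ, and
regularity is invariant under such isomorphisms. -/
theorem QgrCat.exists_regular {X Y : QgrCat k Q} (f : X ⟶ Y) : ∃ g, f ≫ g ≫ f = f := by
  have := Localization.essSurj_mapArrow (piStar k Q) (FpGrMod.isoModFdim k Q)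
  let φ := (piStar k Q).mapArrow.objPreimage (Arrow.mk f)
  let ε : Arrow.mk ((piStar k Q).map φ.hom) ≅ Arrow.mk f :=
    (piStar k Q).mapArrow.objObjPreimageIso (Arrow.mk f)
  obtain ⟨g, hg⟩ := exists_regular_piStar_map φ.hom
  have h₁ : ε.hom.left ≫ f = (piStar k Q).map φ.hom ≫ ε.hom.right := ε.hom.w
  have h₂ : ε.inv.left ≫ (piStar k Q).map φ.hom = f ≫ ε.inv.right := ε.inv.w
  have h₃ : ε.inv.left ≫ ε.hom.left = 𝟙 X := congrArg CommaMorphism.left ε.inv_hom_id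
  refine ⟨ε.inv.right ≫ g ≫ ε.hom.left, ?_⟩
  simp only [Category.assoc]
  rw [← reassoc_of% h₂, h₁, reassoc_of% hg, ← h₁, reassoc_of% h₃]
  exact Category.id_comp f

/-- Cancelling the monomorphism on one side of f g f = f makes the quasi-inverse a retraction; for
an epimorphism it becomes a section. -/
theorem QgrCat.exists_retraction {X Y : QgrCat k Q} (f : X ⟶ Y) [Mono f] :
    ∃ r, f ≫ r = 𝟙 X := by
  obtain ⟨g, hg⟩ := exists_regular f
  exact ⟨g, by rw [← cancel_mono f, Category.assoc, hg, Category.id_comp]⟩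

theorem QgrCat.exists_section {X Y : QgrCat k Q} (f : X ⟶ Y) [Epi f] :
    ∃ s, s ≫ f = 𝟙 Y := by
  obtain ⟨g, hg⟩ := exists_regular f
  exact ⟨g, by rw [← cancel_epi f, hg, Category.comp_id]⟩

/-- `ShortComplex.Splitting.ofExactOfRetraction` asks for a balanced category. -/
instance : Balanced (QgrCat k Q) where
  isIso_of_mono_of_epi f _ _ := by
    obtain ⟨r, hr⟩ := QgrCat.exists_retraction f
    have : IsSplitMono f := ⟨⟨⟨r, hr⟩⟩⟩
    exact isIso_of_epi_of_isSplitMono f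

end Regular
end

theorem mainTheorem3 (k : Type u) [Field k] (Q : Type v) [Quiver.{w} Q] [Fintype Q]
    [∀ i j : Q, Finite (i ⟶ j)] :
    (∀ M : GrMod k Q, Module.Finite (PathAlgebra k Q) M →
      (Module.FinitePresentation (PathAlgebra k Q) M ↔
        ∃ n₀ : ℤ, ∀ n : ℤ, n₀ ≤ n → ∃ m : Q → ℕ,
          Nonempty (M.trunc n ≅
            GrMod.directSum fun a : (i : Q) × Fin (m i) => (GrMod.P k a.1).shift (-n)))) ∧
    (∀ S : ShortComplex (FpGrMod k Q),
      Function.Injective S.f.hom.hom → Function.Exact S.f.hom.hom S.g.hom.hom →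
      Function.Surjective S.g.hom.hom →
        ∃ n₀ : ℤ, ∀ n : ℤ, n₀ ≤ n → Nonempty
          (S.map ((GrMod.isFinitelyPresented k Q).ι ⋙ GrMod.truncFunctor k Q n)).Splitting) ∧
    (∀ X : QgrCat k Q, ∃ M : FpGrMod k Q, Projective M.obj ∧
      Nonempty (X ≅ (piStar k Q).obj M)) ∧
    (∀ S : ShortComplex (QgrCat k Q), S.ShortExact → Nonempty S.Splitting) ∧
    (∀ X : QgrCat k Q, Injective X ∧ Projective X) := by
  have := Fintype.ofFinite (QuiverArrows Q)
  refine ⟨fun M _ => ⟨fun _ => M.exists_trunc_iso, ?_⟩, fun S hf hfg hg => ?_, fun X => ?_,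
    fun S hS => ?_, fun X => ⟨⟨fun {Y Z} g f _ => ?_⟩, ⟨fun {Y Z} f g _ => ?_⟩⟩⟩
  · rintro ⟨n, hn⟩
    obtain ⟨m, ⟨f⟩⟩ := hn n le_rfl
    exact M.finitePresentation_of_trunc_iso f
  · have : Module.FinitePresentation (PathAlgebra k Q)
      (S.map (GrMod.isFinitelyPresented k Q).ι).X₃ := S.X₃.property
    exact GrMod.exists_splitting_truncFunctor (S := S.map (GrMod.isFinitelyPresented k Q).ι)
      hf hfg hg
  · have := Localization.essSurj (piStar k Q) (FpGrMod.isoModFdim k Q)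
    let M := (piStar k Q).objPreimage X
    have : Module.FinitePresentation (PathAlgebra k Q) M.obj := M.property
    obtain ⟨n, hn⟩ := M.obj.exists_projective_trunc
    -- A preimage of X need not be projective, but its high truncation is, and it has the same image
    -- up to isomorphism.
    exact ⟨M.trunc n, hn n le_rfl, ⟨((piStar k Q).objObjPreimageIso X).symm ≪≫
      (asIso ((piStar k Q).map (M.truncι n))).symm⟩⟩
  · have := hS.mono_f
    obtain ⟨r, hr⟩ := QgrCat.exists_retraction S.f
    exact ⟨ShortComplex.Splitting.ofExactOfRetraction S hS.exact r hr hS.epi_g⟩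
  · obtain ⟨r, hr⟩ := QgrCat.exists_retraction f
    exact ⟨r ≫ g, by rw [reassoc_of% hr]⟩
  · obtain ⟨s, hs⟩ := QgrCat.exists_section g
    exact ⟨f ≫ s, by rw [Category.assoc, hs, Category.comp_id]⟩
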